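/- Let $T$ be a complete first-order theory and let $\mathfrak C\models T$ be a monster model, i.e. $\mathfrak C$ is $\kappa$-saturated and strongly $\kappa$-homogeneous for a strong limit cardinal $\kappa>|T|$; a set is called small, and a cardinal bounded, if its size, resp. the cardinal, is less than $\kappa$. Tuples have small length unless said otherwise. Definitions. Types of classes of type-definable equivalence relations over $A$ are orbits under $\mathrm{Aut}(\mathfrak C/A)$. A hyperdefinable set over a small set $A\subset\mathfrak C$ is a quotient $X/E$, where $X\subseteq\mathfrak C^\lambda$ ($\lambda<\kappa$) and the equivalence relation $E$ on $X$ are type-definable over $A$. It is stable if for every $A$-indiscernible sequence $(a_i,b_i)_{i<\omega}$ with $a_i\in X/E$ and $b_i$ tuples of $\mathfrak C$ one has $\mathrm{tp}(a_i,b_j/A)=\mathrm{tp}(a_j,b_i/A)$ for all $i\ne j$. The relation $E$ is bounded if $|X/E|<\kappa$. A cut $(I_1,I_2)$ of a sequence $I=I_1+I_2$ is Dedekind if $I_1$ and the reverse of $I_2$ have infinite cofinality; a tuple $b$ fills it if $I_1+b+I_2$ is indiscernible. The theory $T$ is distal if for every small, densely ordered, indiscernible sequence $I$ of finite tuples of $\mathfrak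 C$ (equivalently, of small tuples) and all $a,b$ filling distinct Dedekind cuts of $I$, the sequence $I\cup\{a\}\cup\{b\}$ (with $a$ and $b$ inserted in their cuts) is indiscernible. Statement. Assume that $T$ is distal. (1) For every small $A\subset\mathfrak C$, a hyperdefinable set $X/E$ over $A$ is stable if and only if $E$ is bounded. (2) Assume also that $T$ has NIP (this is commonly made part of the definition of distality). Then for every group $G$ type-definable over a small set of parameters, the smallest subgroup $G^{st}$ of $G$ that is type-definable over a small set of parameters and has stable quotient $G/G^{st}$, and the smallest subgroup $G^{00}$ of $G$ that is type-definable over a small set of parameters and has bounded index, both exist, and $G^{st}=G^{00}$. -/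

import Mathlib

open FirstOrder Cardinal

universe u v w

namespace Monster

section Model

variable (L : FirstOrder.Language.{u, v}) {M : Type w} [L.Structure M]

/-- `M` is `κ`-saturated: every set of formulas in one free variable, with parameters from a set `A`
of size less than `κ`, that is finitely satisfiable in `M` is realized in `M`. -/
def IsSaturated (κ : Cardinal.{w}) (M : Type w) [L.Structure M] : Prop :=
  ∀ A : Set M, #A < κ → ∀ p : Set (L[[A]].Formula (Fin 1)),
    (∀ q ⊆ p, q.Finite → ∃ m : M, ∀ φ ∈ q, φ.Realize (fun _ => m)) →
      ∃ m : M, ∀ φ ∈ p, φ.Realize (fun _ => m)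

/-- `M` is strongly `κ`-homogeneous: every partial elementary map of `M` whose domain has size less
than `κ` extends to an automorphism of `M`. -/
def IsStronglyHomogeneous (κ : Cardinal.{w}) (M : Type w) [L.Structure M] : Prop :=
  ∀ (A : Set M) (f : A → M), #A < κ →
    (∀ φ : L.Formula A, φ.Realize (fun a : A => (a : M)) ↔ φ.Realize f) →
      ∃ σ : M ≃[L] M, ∀ a : A, σ a = f a

/-- `M` is a monster model (of its complete theory) with respect to `κ`: it is `κ`-saturated and
strongly `κ`-homogeneous, where `κ` is a strong limit cardinal greater than `|L| + ℵ₀`. -/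
structure IsMonster (κ : Cardinal.{w}) (M : Type w) [L.Structure M] : Prop where
  isStrongLimit : κ.IsStrongLimit
  aleph0_lt : ℵ₀ < κ
  card_lt : Cardinal.lift.{w} L.card < Cardinal.lift.{max u v} κ
  saturated : IsSaturated L κ M
  homogeneous : IsStronglyHomogeneous L κ M

/-- A set of tuples is type-definable over `A` if it is an intersection of `A`-definable sets. -/
def TypeDefinable (A : Set M) {α : Type w} (S : Set (α → M)) : Prop :=
  ∃ F : Set (Set (α → M)), (∀ D ∈ F, A.Definable L D) ∧ S = ⋂₀ F

end Model

section Distal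

variable (L : FirstOrder.Language.{u, v}) {M : Type w} [L.Structure M]

/-- The complete theory of `M` has NIP: no formula `φ(x, y)` shatters finite sets of every size. -/
def IsNIP (M : Type w) [L.Structure M] : Prop :=
  ∀ (m n : ℕ) (φ : L.Formula (Fin m ⊕ Fin n)), ∃ k : ℕ,
    ¬ ∃ (a : Fin k → Fin m → M) (b : Set (Fin k) → Fin n → M),
      ∀ (i : Fin k) (S : Set (Fin k)), φ.Realize (Sum.elim (a i) (b S)) ↔ i ∈ S

/-- The sequence `a` of tuples of elements of `M`, indexed by the linear order `I`, is indiscernible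
(over `∅`): all increasing finite subsequences of the same length have the same type. -/
def IsIndiscernible {I : Type w} [LinearOrder I] {γ : Type*} (a : I → γ → M) : Prop :=
  ∀ (n : ℕ) (s t : Fin n ↪o I) (φ : L.Formula (Fin n × γ)),
    φ.Realize (fun p => a (s p.1) p.2) ↔ φ.Realize (fun p => a (t p.1) p.2)

/-- The concatenation `a + b` of two sequences. -/
def concat {I J : Type w} {Z : Type*} (a : I → Z) (b : J → Z) : I ⊕ₗ J → Z :=
  fun k => Sum.elim a b (ofLex k)

/-- The sequence of length one with entry `b`. -/
def single {Z : Type*} (b : Z) : PUnit.{w + 1} → Z := fun _ => b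

/-- The restriction of a sequence to a set of indices. -/
def restr {I : Type w} {Z : Type*} (a : I → Z) (C : Set I) : C → Z := fun i => a i

/-- The cut of `I` with left part `C` (an initial segment) and right part `Cᶜ` is Dedekind: `C` and
the reverse of `Cᶜ` have infinite cofinality, i.e. they are nonempty, `C` has no greatest and `Cᶜ`
has no least element. -/
structure IsDedekindCut {I : Type w} [LinearOrder I] (C : Set I) : Prop where
  isLowerSet : IsLowerSet C
  left_nonempty : C.Nonempty
  left_noMax : ∀ i ∈ C, ∃ j ∈ C, i < j
  right_nonempty : Cᶜ.Nonempty
  right_noMin : ∀ i ∈ Cᶜ, ∃ j ∈ Cᶜ, j < i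

/-- The tuple `b` fills the cut of the sequence `a` with left part `C`:
the sequence `I₁ + b + I₂` is indiscernible. -/
def Fills {I : Type w} [LinearOrder I] {γ : Type*} (a : I → γ → M) (C : Set I) (b : γ → M) : Prop :=
  IsIndiscernible L (concat (restr a C) (concat (single b) (restr a Cᶜ)))

/-- The (indiscernible) sequence `a` is distal: whenever `b₁` and `b₂` fill distinct Dedekind cuts
(named so that the first one lies to the left of the second one), the sequence
`I₁ + b₁ + I₂ + b₂ + I₃` is indiscernible. -/
def IsDistalSeq {I : Type w} [LinearOrder I] {γ : Type*} (a : I → γ → M) : Prop :=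
  ∀ C₁ C₂ : Set I, IsDedekindCut C₁ → IsDedekindCut C₂ → C₁ ⊂ C₂ →
    ∀ b₁ b₂ : γ → M, Fills L a C₁ b₁ → Fills L a C₂ b₂ →
      IsIndiscernible L (concat (restr a C₁) (concat (single b₁)
        (concat (restr a (C₂ \ C₁)) (concat (single b₂) (restr a C₂ᶜ)))))

/-- The complete theory of the monster model `M` is distal: all dense indiscernible (small) sequences
of finite tuples are distal. Since a formula involves only finitely many coordinates, it would be
equivalent to allow infinite tuples. -/
def IsDistal (κ : Cardinal.{w}) (M : Type w) [L.Structure M] : Prop :=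
  ∀ (I : Type w) [LinearOrder I] [DenselyOrdered I], #I < κ →
    ∀ (n : ℕ) (a : I → Fin n → M), IsIndiscernible L a → IsDistalSeq L a

end Distal

section Hyperdefinable

variable (L : FirstOrder.Language.{u, v}) {M : Type w} [L.Structure M]

/-- `X / E` is a hyperdefinable set over `A`: both the set `X` of tuples and the equivalence relation
`E` on `X` are type-definable over `A`. -/
structure IsHyperdefinable (A : Set M) {α : Type w} (X : Set (α → M)) (E : Setoid X) : Prop where
  typeDefinable_set : TypeDefinable L A X
  typeDefinable_rel :
    TypeDefinable L A {p : α ⊕ α → M | ∃ x y : X, E x y ∧ p = Sum.elim (x : α → M) (y : α → M)}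

/-- The equivalence relation `E` on `X` is bounded: it has fewer than `κ` classes. -/
def IsBoundedRel (κ : Cardinal.{w}) {α : Type w} {X : Set (α → M)} (E : Setoid X) : Prop :=
  #(Quotient E) < κ

/-- The automorphism `σ` of `M` maps the class `c ∈ X / E` to the class `c' ∈ X / E`. -/
def MapsClass (σ : M ≃[L] M) {α : Type w} {X : Set (α → M)} {E : Setoid X}
    (c c' : Quotient E) : Prop :=
  ∃ x x' : X, Quotient.mk E x = c ∧ Quotient.mk E x' = c' ∧
    ∀ i, σ ((x : α → M) i) = (x' : α → M) i

/-- `tp((c k, b k)ₖ / A) = tp((c' k, b' k)ₖ / A)`, where the `c k`, `c' k` are elements of the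
hyperdefinable set `X / E` and the `b k`, `b' k` are tuples from `M`: the two families are conjugate
under an automorphism of `M` over `A`. -/
def SameType (A : Set M) {α β : Type w} {X : Set (α → M)} {E : Setoid X} {K : Type*}
    (c : K → Quotient E) (b : K → β → M) (c' : K → Quotient E) (b' : K → β → M) : Prop :=
  ∃ σ : M ≃[L] M, (∀ m ∈ A, σ m = m) ∧
    ∀ k, MapsClass L σ (c k) (c' k) ∧ ∀ j, σ (b k j) = b' k j

/-- The sequence `(c i, b i)_{i < ω}` of pairs consisting of an element of `X / E` and a tuple from
`M` is `A`-indiscernible. -/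
def IsIndiscernibleHyp (A : Set M) {α β : Type w} {X : Set (α → M)} {E : Setoid X}
    (c : ℕ → Quotient E) (b : ℕ → β → M) : Prop :=
  ∀ (n : ℕ) (s t : Fin n ↪o ℕ), SameType L A (c ∘ s) (b ∘ s) (c ∘ t) (b ∘ t)

/-- The hyperdefinable (over `A`) set `X / E` is stable: for every `A`-indiscernible sequence
`(c i, b i)_{i < ω}` with `c i ∈ X / E` (and `b i` tuples of some length less than `κ`) one has
`tp(c i, b j / A) = tp(c j, b i / A)` for all `i ≠ j`. -/
def IsStable (κ : Cardinal.{w}) (A : Set M) {α : Type w} {X : Set (α → M)} (E : Setoid X) : Prop :=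
  ∀ (β : Type w), #β < κ → ∀ (c : ℕ → Quotient E) (b : ℕ → β → M),
    IsIndiscernibleHyp L A c b → ∀ i j : ℕ, i ≠ j →
      SameType L A (fun _ : Unit => c i) (fun _ => b j) (fun _ => c j) (fun _ => b i)

end Hyperdefinable

section Groups

variable (L : FirstOrder.Language.{u, v}) {M : Type w} [L.Structure M]

/-- `G` is a group type-definable over `A`: the underlying set and the graph of the multiplication
are type-definable over `A`. -/
structure IsTypeDefinableGroup (A : Set M) {α : Type w} (G : Set (α → M)) [Group G] : Prop where
  typeDefinable_set : TypeDefinable L A G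
  typeDefinable_mul : TypeDefinable L A {p : α ⊕ α ⊕ α → M | ∃ x y : G,
    p = Sum.elim (x : α → M) (Sum.elim (y : α → M) ((x * y : G) : α → M))}

/-- The subgroup `H` of `G` is type-definable over `B`. -/
def IsTypeDefinableSubgroup (B : Set M) {α : Type w} {G : Set (α → M)} [Group G]
    (H : Subgroup G) : Prop :=
  TypeDefinable L B ((fun g : G => (g : α → M)) '' (H : Set G))

/-- `H` is `G⁰⁰`, the smallest type-definable (over a small set of parameters) subgroup of `G` of
bounded index. -/
def IsG00 (κ : Cardinal.{w}) {α : Type w} (G : Set (α → M)) [Group G] (H : Subgroup G) : Prop :=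
  IsLeast {K : Subgroup G | (∃ B : Set M, #B < κ ∧ IsTypeDefinableSubgroup L B K) ∧ #(G ⧸ K) < κ} H

/-- `H` is `Gˢᵗ`, the smallest type-definable (over a small set of parameters) subgroup of `G` with
stable quotient; here `G` is type-definable over `A`. For a subgroup `K` type-definable over
`B ⊇ A`, the quotient `G / K` is the hyperdefinable set over `B` given by the relation of lying in
the same left coset of `K`. -/
def IsGst (κ : Cardinal.{w}) (A : Set M) {α : Type w} (G : Set (α → M)) [Group G]
    (H : Subgroup G) : Prop :=
  IsLeast {K : Subgroup G | ∃ B : Set M, #B < κ ∧ A ⊆ B ∧ IsTypeDefinableSubgroup L B K ∧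
    IsStable L κ B (QuotientGroup.leftRel K)} H

end Groups

end Monster

/-!
Why the theorem is true.

**Stable and bounded.** If `E` is bounded, an indiscernible sequence in `X / E` is constant:
otherwise a definable neighbourhood of `E` separates its terms uniformly, and compactness gives
longer separated sequences than there are classes (`IsBoundedRel.not_separated`). For a constant
sequence of classes the symmetry required by stability is part of indiscernibility.

Conversely, if `E` is not bounded, then for some definable neighbourhood `D` of `E` no finite number
of `D`-translates covers `X`, since otherwise a class would be determined by the translates that it
meets (`IsHyperdefinable.isBoundedRel`). So there is an infinite sequence of `D`-separated points of
`X`, and by Ramsey's theorem and compactness an `A`-indiscernible one, `(a j)`, over any small linear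
order. Pair the classes of some terms `a p₀, a p₁, …` with tuples `b₀, b₁, …`, where `bᵢ` enumerates
a dense block between `pᵢ` and `pᵢ₊₁` together with fixed blocks to the left and to the right of
everything. Stability yields an automorphism over `A` that takes `b₁` to `b₀` and the class of
`a p₀`, which lies to the left of the middle block of `b₁`, to the class of `a p₁`, which lies to
the right of the middle block of `b₀`. The image `e` of `a p₀` and `a p₁` then fill the two cuts of
`b₀`, so by distality inserting both keeps the sequence `A`-indiscernible. But `e` and `a p₁` are
`E`-equivalent, whereas other pairs of terms are `D`-separated (`IsStable.isBoundedRel`).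

**Groups.** By the first part, the subgroups competing for `Gˢᵗ` and for `G⁰⁰` are the same, and it
remains to see that `G⁰⁰` exists under NIP (`IsTypeDefinableGroup.exists_isG00`). A type-definable
subgroup of bounded index is an intersection of subgroups `⋂ n, D n` with `D n` definable,
`(D (n + 1))⁻¹ * D (n + 1) ⊆ D n` in `G`, and such that finitely many translates of each `D n`
cover `G`. Such chains are sorted by the formula defining `D 2` and by the numbers of translates.
In each of the few resulting families, finitely many chains suffice to cut `G` down to a subset of
each `D 0`. Otherwise there are chains `D i` and elements `c i` outside `D i 0` that belong to all
earlier subgroups; by Ramsey's theorem and the covering condition one may choose quotients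
`d = c⁻¹ * c'` such that each lies outside a level of its own chain and, up to a deep level, inside
the other chains, and then the products of the `d` over subsets show that the formula of the `D i 2`
has the independence property (`exists_shattered`). The intersection of the chosen subgroups is
`G⁰⁰`.

The tools are compactness for small sets of variables (`IsMonster.sInter_nonempty`), which is
derived from saturation in one variable by extending partial solutions maximally, and Ramsey's
theorem (`large_or_large_not`, `exists_strictMono_of_large`).
-/

namespace Monster

open FirstOrder.Language Set

variable {L : FirstOrder.Language.{u, v}} {M : Type w} [L.Structure M] {κ : Cardinal.{w}}

/-! ### Definable sets in infinitely many variables -/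

/-- A definable set constrains only finitely many coordinates. -/
theorem exists_finset_support {A : Set M} {V : Type*} {D : Set (V → M)} (hD : A.Definable L D) :
    ∃ F : Finset V, ∀ v v' : V → M, (∀ x ∈ F, v x = v' x) → (v ∈ D ↔ v' ∈ D) := by
  classical
  obtain ⟨φ, rfl⟩ := hD
  refine ⟨φ.freeVarFinset, fun v v' h => ?_⟩
  have h1 := BoundedFormula.realize_restrictFreeVar (φ := φ) (f := id) (v := fun a => v a)
    (xs := default) v (fun _ => rfl)
  have h2 := BoundedFormula.realize_restrictFreeVar (φ := φ) (f := id) (v := fun a => v a)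
    (xs := default) v' (fun a => h a a.2)
  exact h1.symm.trans h2

/-- Existential quantification over an arbitrary tuple preserves definability. -/
theorem definable_exists [Nonempty M] {A : Set M} {V W : Type*} {D : Set (V ⊕ W → M)}
    (hD : A.Definable L D) : A.Definable L {v : V → M | ∃ u : W → M, Sum.elim v u ∈ D} := by
  classical
  obtain ⟨F, hF⟩ := exists_finset_support hD
  have m₀ : M := Classical.arbitrary M
  -- only the finitely many variables of `W` in the support matter; the others are all identified
  let g : V ⊕ W → V ⊕ Option F.toRight :=
    Sum.elim Sum.inl (fun x => Sum.inr (if h : x ∈ F.toRight then some ⟨x, h⟩ else none))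
  convert (hD.preimage_comp (α := V ⊕ W) (β := V ⊕ Option F.toRight) g).exists_of_finite using 1
  ext v
  simp only [mem_ofPred_eq, mem_preimage]
  constructor
  · rintro ⟨u, hu⟩
    refine ⟨fun o => o.elim m₀ (fun x => u x), (hF _ _ ?_).1 hu⟩
    rintro (x | x) hx
    · rfl
    · have : x ∈ F.toRight := by simpa using hx
      show u x = Option.elim (if h : x ∈ F.toRight then some (⟨x, h⟩ : F.toRight) else none) m₀
        fun x => u x
      rw [dif_pos this]
      rfl
  · rintro ⟨u, hu⟩
    refine ⟨fun x => u (if h : x ∈ F.toRight then some ⟨x, h⟩ else none), (hF _ _ ?_).1 hu⟩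
    rintro (x | x) hx <;> rfl

theorem definable_eq_const {A : Set M} {V : Type*} (x : V) {m : M} (hm : m ∈ A) :
    A.Definable L {v : V → M | v x = m} :=
  (Definable.singleton_of_mem L hm).preimage_comp (β := V) (fun _ => x)

theorem definable_eq {A : Set M} {V : Type*} (x y : V) :
    A.Definable L {v : V → M | v x = v y} :=
  (Definable.diagonal L A).preimage_comp (β := V) ![x, y]

theorem definable_sInter {A : Set M} {V : Type*} {F : Set (Set (V → M))} (hF : F.Finite)
    (h : ∀ D ∈ F, A.Definable L D) : A.Definable L (⋂₀ F) := by
  have := hF.to_subtype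
  rw [sInter_eq_iInter]
  exact definable_iInter_of_finite fun D => h D D.2

/-! ### Saturation for types in several variables -/

theorem IsSaturated.sInter_nonempty_one (hM : IsSaturated L κ M) {A : Set M} (hA : #A < κ)
    {F : Set (Set (Fin 1 → M))} (hF : ∀ D ∈ F, A.Definable L D)
    (fip : ∀ G ⊆ F, G.Finite → (⋂₀ G).Nonempty) : (⋂₀ F).Nonempty := by
  obtain ⟨m, hm⟩ := hM A hA {ψ | Set.ofPred ψ.Realize ∈ F} (fun q hq hfin => by
    obtain ⟨w, hw⟩ := fip ((fun ψ : L[[A]].Formula (Fin 1) => Set.ofPred ψ.Realize) '' q)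
      (by rintro _ ⟨ψ, hψ, rfl⟩; exact hq hψ) (hfin.image _)
    refine ⟨w 0, fun φ hφ => ?_⟩
    have : w ∈ Set.ofPred φ.Realize := hw _ ⟨φ, hφ, rfl⟩
    have hw0 : (fun _ => w 0) = w := funext fun i => by rw [Subsingleton.elim i 0]
    rw [hw0]; exact this)
  refine ⟨fun _ => m, fun D hD => ?_⟩
  obtain ⟨φ, rfl⟩ := hF D hD
  exact hm φ hD

theorem IsMonster.mk_lt_of_countable (hM : IsMonster L κ M) {V : Type w} [Countable V] : #V < κ :=
  mk_le_aleph0.trans_lt hM.aleph0_lt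

theorem IsMonster.mk_prod_lt (hM : IsMonster L κ M) {V W : Type w} (hV : #V < κ) (hW : #W < κ) :
    #(V × W) < κ := by
  rw [mk_prod, lift_id, lift_id]
  exact mul_lt_of_lt hM.aleph0_lt.le hV hW

theorem IsMonster.mk_fin_prod_lt (hM : IsMonster L κ M) (n : ℕ) {W : Type w} (hW : #W < κ) :
    #(Fin n × W) < κ := by
  rw [mk_prod, mk_fin, lift_natCast, lift_uzero]
  exact mul_lt_of_lt hM.aleph0_lt.le (natCast_lt_aleph0.trans hM.aleph0_lt) hW

theorem IsMonster.mk_sum_lt (hM : IsMonster L κ M) {V W : Type w} (hV : #V < κ) (hW : #W < κ) :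
    #(V ⊕ W) < κ := by
  rw [mk_sum, lift_id, lift_id]
  exact add_lt_of_lt hM.aleph0_lt.le hV hW

theorem IsMonster.mk_union_lt (hM : IsMonster L κ M) {A B : Set M} (hA : #A < κ) (hB : #B < κ) :
    #(A ∪ B : Set M) < κ :=
  (mk_union_le _ _).trans_lt (add_lt_of_lt hM.aleph0_lt.le hA hB)

/-- Saturation for a small set of variables: a finitely satisfiable family of sets of small
tuples, definable over a common small set, has a common point. -/
theorem IsMonster.sInter_nonempty [Nonempty M] (hM : IsMonster L κ M) {A : Set M} (hA : #A < κ)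
    {V : Type w} (hV : #V < κ) {F : Set (Set (V → M))} (hF : ∀ D ∈ F, A.Definable L D)
    (fip : ∀ G ⊆ F, G.Finite → (⋂₀ G).Nonempty) : (⋂₀ F).Nonempty := by
  classical
  -- partial solutions are represented by their graphs; a maximal one is shown to be total
  let P : Set (Set (V × M)) :=
    {Γ | ∀ G ⊆ F, G.Finite → ∃ v ∈ ⋂₀ G, ∀ p ∈ Γ, v p.1 = p.2}
  have hfun : ∀ Γ ∈ P, ∀ p ∈ Γ, ∀ q ∈ Γ, p.1 = q.1 → p = q := by
    intro Γ hΓ p hp q hq h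
    obtain ⟨v, -, hv⟩ := hΓ ∅ (empty_subset _) finite_empty
    exact Prod.ext h (by rw [← hv p hp, ← hv q hq, h])
  have hempty : ∅ ∈ P := fun G hG hfin => by
    obtain ⟨v, hv⟩ := fip G hG hfin
    exact ⟨v, hv, by simp⟩
  obtain ⟨Γ, -, hΓ⟩ := zorn_subset_nonempty P (fun c hc hchain hne => by
    refine ⟨⋃₀ c, fun G hG hfin => ?_, fun s hs => subset_sUnion_of_mem hs⟩
    obtain ⟨T, hT⟩ := exists_finset_support (definable_sInter hfin fun D hD => hF D (hG hD))
    have hfun' : ∀ p ∈ ⋃₀ c, ∀ q ∈ ⋃₀ c, p.1 = q.1 → p = q := by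
      rintro p ⟨s, hs, hp⟩ q ⟨t, ht, hq⟩ h
      obtain ⟨r, hr, h1, h2⟩ := hchain.directedOn s hs t ht
      exact hfun r (hc hr) p (h1 hp) q (h2 hq) h
    have hfin' : {p ∈ ⋃₀ c | p.1 ∈ T}.Finite := by
      refine Finite.of_finite_image (f := Prod.fst) (T.finite_toSet.subset ?_) ?_
      · rintro _ ⟨p, hp, rfl⟩; exact hp.2
      · intro p hp q hq h; exact hfun' p hp.1 q hq.1 h
    obtain ⟨Γ₀, hΓ₀, hsub⟩ := hchain.directedOn.exists_mem_subset_of_finite_of_subset_sUnion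
      hne hfin' (fun p hp => hp.1)
    obtain ⟨v, hv, hvΓ⟩ := hc hΓ₀ G hG hfin
    -- `Γ₀` contains the part of `⋃₀ c` over the support `T`, so that a solution for `Γ₀` may be
    -- changed outside `T` to one that extends all of `⋃₀ c`
    refine ⟨fun x => if h : ∃ m, (x, m) ∈ ⋃₀ c then h.choose else v x, (hT _ _ ?_).1 hv, ?_⟩
    · intro x hx
      split_ifs with h
      · exact hvΓ (x, h.choose) (hsub ⟨h.choose_spec, hx⟩)
      · rfl
    · intro p hp
      have h : ∃ m, (p.1, m) ∈ ⋃₀ c := ⟨p.2, hp⟩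
      refine (dif_pos h).trans ?_
      exact congrArg Prod.snd (hfun' _ h.choose_spec p hp rfl)) ∅ hempty
  have htotal : ∀ x, ∃ m, (x, m) ∈ Γ := by
    by_contra! hx
    obtain ⟨x, hx⟩ := hx
    let B : Set M := A ∪ Prod.snd '' Γ
    have hB : #B < κ := by
      refine hM.mk_union_lt hA ?_
      refine (mk_image_le.trans ?_).trans_lt hV
      exact mk_le_of_injective (f := fun p : Γ => p.1.1)
        fun p q h => Subtype.ext (hfun Γ hΓ.1 _ p.2 _ q.2 h)
    -- the possible values at `x` of the solutions of `G` that extend `Γ`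
    let S : Set (Set (V → M)) → Set (Fin 1 → M) := fun G =>
      {w | ∃ v ∈ ⋂₀ G, (∀ p ∈ Γ, v p.1 = p.2) ∧ v x = w 0}
    have hS : ∀ G ⊆ F, G.Finite → B.Definable L (S G) := by
      intro G hG hfin
      have hdef : A.Definable L (⋂₀ G) := definable_sInter hfin fun D hD => hF D (hG hD)
      obtain ⟨T, hT⟩ := exists_finset_support hdef
      have hfinT : {p ∈ Γ | p.1 ∈ T}.Finite := by
        refine Finite.of_finite_image (f := Prod.fst) (T.finite_toSet.subset ?_) ?_
        · rintro _ ⟨p, hp, rfl⟩; exact hp.2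
        · intro p hp q hq h; exact hfun Γ hΓ.1 p hp.1 q hq.1 h
      -- only the finite part of `Γ` over the support `T` of `⋂₀ G` is a constraint
      let D : Set (Fin 1 ⊕ V → M) := ((fun g => g ∘ Sum.inr) ⁻¹' (⋂₀ G)) ∩
        ⋂₀ ((fun p : V × M => {g | g (Sum.inr p.1) = p.2}) '' {p ∈ Γ | p.1 ∈ T}) ∩
          {g | g (Sum.inr x) = g (Sum.inl 0)}
      have hD : B.Definable L D := by
        refine (((hdef.mono subset_union_left).preimage_comp _).inter
          (definable_sInter (hfinT.image _) ?_)).inter (definable_eq _ _)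
        rintro _ ⟨p, hp, rfl⟩
        exact definable_eq_const _ (Or.inr ⟨p, hp.1, rfl⟩)
      convert! definable_exists hD using 1
      ext w
      constructor
      · rintro ⟨v, hv, hvΓ, hvx⟩
        refine ⟨v, ⟨hv, ?_⟩, hvx⟩
        rintro _ ⟨p, hp, rfl⟩
        exact hvΓ p hp.1
      · rintro ⟨v, ⟨hv, hv'⟩, hvx⟩
        refine ⟨fun y => if h : ∃ m, (y, m) ∈ Γ then h.choose else v y, (hT _ _ ?_).1 hv, ?_, ?_⟩
        · intro y hy
          split_ifs with h
          · exact hv' _ ⟨_, ⟨h.choose_spec, hy⟩, rfl⟩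
          · rfl
        · intro p hp
          have h : ∃ m, (p.1, m) ∈ Γ := ⟨p.2, hp⟩
          refine (dif_pos h).trans ?_
          exact congrArg Prod.snd (hfun Γ hΓ.1 _ h.choose_spec p hp rfl)
        · exact (dif_neg (fun ⟨m, hm⟩ => hx m hm)).trans hvx
    obtain ⟨w, hw⟩ := hM.saturated.sInter_nonempty_one hB
      (F := {D | ∃ G ⊆ F, G.Finite ∧ D = S G})
      (by rintro _ ⟨G, hG, hfin, rfl⟩; exact hS G hG hfin) (fun 𝓖 h𝓖 hfin => by
        choose! G hG1 hG2 hG3 using fun D hD => h𝓖 (a := D) hD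
        obtain ⟨v, hv, hvΓ⟩ := hΓ.1 (⋃ D ∈ 𝓖, G D) (iUnion₂_subset fun D hD => hG1 D hD)
          (hfin.biUnion fun D hD => hG2 D hD)
        refine ⟨fun _ => v x, fun D hD => ?_⟩
        rw [hG3 D hD]
        exact ⟨v, fun E hE => hv E (mem_biUnion hD hE), hvΓ, rfl⟩)
    have hins : insert (x, w 0) Γ ∈ P := fun G hG hfin => by
      obtain ⟨v, hv, hvΓ, hvx⟩ := hw (S G) ⟨G, hG, hfin, rfl⟩
      refine ⟨v, hv, ?_⟩
      rintro p (rfl | hp)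
      · exact hvx
      · exact hvΓ p hp
    exact hx (w 0) (hΓ.2 hins (subset_insert _ _) (mem_insert _ _))
  choose m hm using htotal
  refine ⟨m, fun D hD => ?_⟩
  obtain ⟨v, hv, hvΓ⟩ := hΓ.1 {D} (by simpa using hD) (finite_singleton D)
  have : v = m := funext fun x => hvΓ (x, m x) (hm x)
  simpa [this] using hv

/-! ### Type-definable sets -/

section TypeDefinable

variable {A B : Set M} {V W : Type w}

theorem typeDefinable_of_definable {D : Set (V → M)} (hD : A.Definable L D) :
    TypeDefinable L A D := ⟨{D}, by simpa using hD, by simp⟩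

theorem TypeDefinable.mono {S : Set (V → M)} (h : TypeDefinable L A S) (hAB : A ⊆ B) :
    TypeDefinable L B S := by
  obtain ⟨F, hF, rfl⟩ := h
  exact ⟨F, fun D hD => (hF D hD).mono hAB, rfl⟩

theorem typeDefinable_iInter {ι : Sort*} {S : ι → Set (V → M)} (h : ∀ i, TypeDefinable L A (S i)) :
    TypeDefinable L A (⋂ i, S i) := by
  choose F hF hS using h
  refine ⟨⋃ i, F i, fun D hD => ?_, ?_⟩
  · obtain ⟨i, hi⟩ := mem_iUnion.1 hD
    exact hF i D hi
  · rw [sInter_iUnion]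
    exact iInter_congr hS

theorem TypeDefinable.inter {S T : Set (V → M)} (hS : TypeDefinable L A S)
    (hT : TypeDefinable L A T) : TypeDefinable L A (S ∩ T) := by
  rw [inter_eq_iInter]
  exact typeDefinable_iInter (by rintro (_ | _) <;> assumption)

theorem TypeDefinable.preimage_comp (f : V → W) {S : Set (V → M)} (h : TypeDefinable L A S) :
    TypeDefinable L A ((fun g : W → M => g ∘ f) ⁻¹' S) := by
  obtain ⟨F, hF, rfl⟩ := h
  refine ⟨(fun D => (fun g : W → M => g ∘ f) ⁻¹' D) '' F, ?_, ?_⟩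
  · rintro _ ⟨D, hD, rfl⟩
    exact (hF D hD).preimage_comp f
  · rw [sInter_image, preimage_sInter]

variable (L) in
/-- The `A`-definable neighbourhoods of a set of tuples. -/
def DefNhds (A : Set M) {V : Type w} (S : Set (V → M)) : Set (Set (V → M)) :=
  {D | A.Definable L D ∧ S ⊆ D}

theorem TypeDefinable.mem_iff {S : Set (V → M)} (h : TypeDefinable L A S) {v : V → M} :
    v ∈ S ↔ ∀ D ∈ DefNhds L A S, v ∈ D := by
  refine ⟨fun hv D hD => hD.2 hv, fun hv => ?_⟩
  obtain ⟨F, hF, rfl⟩ := h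
  exact fun D hD => hv D ⟨hF D hD, sInter_subset_of_mem hD⟩

theorem univ_mem_defNhds (S : Set (V → M)) : Set.univ ∈ DefNhds L A S :=
  ⟨definable_univ, subset_univ S⟩

theorem inter_mem_defNhds {S D D' : Set (V → M)} (h : D ∈ DefNhds L A S)
    (h' : D' ∈ DefNhds L A S) : D ∩ D' ∈ DefNhds L A S :=
  ⟨h.1.inter h'.1, subset_inter h.2 h'.2⟩

/-- Compactness: a directed family of nonempty type-definable sets has a common point. -/
theorem IsMonster.iInter_nonempty [Nonempty M] (hM : IsMonster L κ M) (hA : #A < κ)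
    (hV : #V < κ) {ι : Type*} [Nonempty ι] {S : ι → Set (V → M)}
    (hS : ∀ i, TypeDefinable L A (S i)) (hdir : Directed (· ⊇ ·) S) (hne : ∀ i, (S i).Nonempty) :
    (⋂ i, S i).Nonempty := by
  obtain ⟨v, hv⟩ := hM.sInter_nonempty hA hV (F := {D | A.Definable L D ∧ ∃ i, S i ⊆ D})
    (fun D hD => hD.1) (fun G hG hfin => by
      choose! i hi using fun D (hD : D ∈ G) => (hG hD).2
      have := hfin.to_subtype
      obtain ⟨j, hj⟩ := hdir.finite_le (fun D : G => i D)
      exact (hne j).mono fun v hv D hD => hi D hD (hj ⟨D, hD⟩ hv))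
  refine ⟨v, mem_iInter.2 fun i => (hS i).mem_iff.2 fun D hD => hv D ⟨hD.1, i, hD.2⟩⟩

/-- Compactness in contrapositive form: if no point of the type-definable set `S` satisfies the
type-definable condition `T`, then no point of some definable neighbourhood of `S` does. The set `S`
is allowed to constrain several tuples `v ∘ f j` read off from `v`. -/
theorem IsMonster.exists_nhds [Nonempty M] (hM : IsMonster L κ M) (hA : #A < κ)
    (hV : #V < κ) {J : Type*} {f : J → W → V} {S : Set (W → M)} (hS : TypeDefinable L A S)
    {T : Set (V → M)} (hT : TypeDefinable L A T)
    (h : ∀ v ∈ T, (∀ j, v ∘ f j ∈ S) → False) :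
    ∃ D ∈ DefNhds L A S, ∀ v ∈ T, (∀ j, v ∘ f j ∈ D) → False := by
  by_contra! hcon
  have : Nonempty (DefNhds L A S) := ⟨Set.univ, univ_mem_defNhds S⟩
  obtain ⟨v, hv⟩ := hM.iInter_nonempty hA hV
    (S := fun D : DefNhds L A S => T ∩ ⋂ j, (fun v : V → M => v ∘ f j) ⁻¹' D)
    (fun D => hT.inter (typeDefinable_iInter
      (S := fun j => (fun v : V → M => v ∘ f j) ⁻¹' (D : Set (W → M))) fun j =>
        TypeDefinable.preimage_comp (f j) (typeDefinable_of_definable D.2.1)))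
    (fun D D' => ⟨⟨D ∩ D', inter_mem_defNhds D.2 D'.2⟩,
      inter_subset_inter_right _ (iInter_mono fun j => preimage_mono inter_subset_left),
      inter_subset_inter_right _ (iInter_mono fun j => preimage_mono inter_subset_right)⟩)
    (fun D => by
      obtain ⟨v, hvT, hv, -⟩ := hcon D D.2
      exact ⟨v, hvT, mem_iInter.2 hv⟩)
  rw [mem_iInter] at hv
  exact h v (hv ⟨Set.univ, univ_mem_defNhds S⟩).1 fun j =>
    hS.mem_iff.2 fun D hD => mem_iInter.1 (hv ⟨D, hD⟩).2 j

/-- Projections of type-definable sets are type-definable, over the same parameters. -/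
theorem TypeDefinable.exists [Nonempty M] (hM : IsMonster L κ M) (hA : #A < κ)
    (hV : #V < κ) (hW : #W < κ) {S : Set (V ⊕ W → M)} (hS : TypeDefinable L A S) :
    TypeDefinable L A {v : V → M | ∃ u : W → M, Sum.elim v u ∈ S} := by
  refine ⟨DefNhds L A {v : V → M | ∃ u : W → M, Sum.elim v u ∈ S}, fun D hD => hD.1, ?_⟩
  refine Subset.antisymm (fun v hv D hD => hD.2 hv) fun v hv => ?_
  have hB : #(A ∪ range v : Set M) < κ :=
    hM.mk_union_lt hA (mk_range_le.trans_lt hV)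
  have : Nonempty (DefNhds L A S) := ⟨Set.univ, univ_mem_defNhds S⟩
  have hv' := mem_sInter.1 hv
  obtain ⟨g, hg⟩ := hM.iInter_nonempty hB (hM.mk_sum_lt hV hW)
    (S := fun D : DefNhds L A S => (⋂ x, {g : V ⊕ W → M | g (Sum.inl x) = v x}) ∩ D)
    (fun D => TypeDefinable.inter (typeDefinable_iInter fun x => typeDefinable_of_definable
      (definable_eq_const (A := A ∪ range v) (Sum.inl x) (Or.inr (mem_range_self x))))
        (typeDefinable_of_definable (D.2.1.mono subset_union_left)))
    (fun D D' => ⟨⟨D ∩ D', inter_mem_defNhds D.2 D'.2⟩,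
      inter_subset_inter_right _ inter_subset_left, inter_subset_inter_right _ inter_subset_right⟩)
    (fun D => by
      obtain ⟨u, hu⟩ := hv' {v | ∃ u : W → M, Sum.elim v u ∈ (D : Set (V ⊕ W → M))}
        ⟨definable_exists D.2.1, fun v ⟨u, hu⟩ => ⟨u, D.2.2 hu⟩⟩
      exact ⟨Sum.elim v u, mem_iInter.2 fun x => rfl, hu⟩)
  rw [mem_iInter] at hg
  refine ⟨g ∘ Sum.inr, hS.mem_iff.2 fun D hD => ?_⟩
  have : g ∘ Sum.inl = v := funext fun x => mem_iInter.1 (hg ⟨D, hD⟩).1 x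
  rw [← this, Sum.elim_comp_inl_inr]
  exact (hg ⟨D, hD⟩).2

/-! ### Automorphisms -/

theorem aut_mem_iff {A : Set M} {V : Type*} {D : Set (V → M)} (hD : A.Definable L D) (σ : M ≃[L] M)
    (hσ : ∀ m ∈ A, σ m = m) (v : V → M) : σ ∘ v ∈ D ↔ v ∈ D := by
  obtain ⟨φ, rfl⟩ := definable_iff_exists_formula_sum.1 hD
  have : (Sum.elim (fun a : A => (a : M)) (σ ∘ v)) = σ ∘ Sum.elim (fun a : A => (a : M)) v := by
    ext (a | x)
    · exact (hσ a a.2).symm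
    · rfl
  show φ.Realize _ ↔ φ.Realize _
  rw [this]
  exact StrongHomClass.realize_formula σ φ

theorem aut_mem_iff_of_typeDefinable {S : Set (V → M)} (hS : TypeDefinable L A S) (σ : M ≃[L] M)
    (hσ : ∀ m ∈ A, σ m = m) (v : V → M) : σ ∘ v ∈ S ↔ v ∈ S := by
  obtain ⟨F, hF, rfl⟩ := hS
  exact forall₂_congr fun D hD => aut_mem_iff (hF D hD) σ hσ v

/-- Tuples of the same type over a small set `A` are conjugate over `A`. -/
theorem IsMonster.exists_aut (hM : IsMonster L κ M) (hA : #A < κ) (hV : #V < κ) (u u' : V → M)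
    (h : ∀ D : Set (V → M), A.Definable L D → (u ∈ D ↔ u' ∈ D)) :
    ∃ σ : M ≃[L] M, (∀ m ∈ A, σ m = m) ∧ σ ∘ u = u' := by
  classical
  let t : A ⊕ V → M := Sum.elim (fun a => a) u
  let t' : A ⊕ V → M := Sum.elim (fun a => a) u'
  have ht : ∀ φ : L.Formula (A ⊕ V), φ.Realize t ↔ φ.Realize t' := fun φ =>
    h {v | φ.Realize (Sum.elim (fun a : A => (a : M)) v)}
      (definable_iff_exists_formula_sum.2 ⟨φ, rfl⟩)
  let g : range t → A ⊕ V := fun m => m.2.choose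
  have hg : ∀ m, t (g m) = m := fun m => m.2.choose_spec
  have heq : ∀ x y, t x = t y → t' x = t' y := fun x y hxy => by
    have := ht ((Term.var x).equal (Term.var y))
    simp only [Formula.realize_equal, Term.realize_var] at this
    exact this.1 hxy
  obtain ⟨σ, hσ⟩ := hM.homogeneous (range t) (fun m => t' (g m))
    (mk_range_le.trans_lt (hM.mk_sum_lt hA hV))
    (fun φ => by
      have := ht (φ.relabel g)
      simp only [Formula.realize_relabel] at this
      rwa [show t ∘ g = fun m : range t => (m : M) from funext hg] at this)
  have key : ∀ x, σ (t x) = t' x := fun x =>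
    (hσ ⟨t x, mem_range_self x⟩).trans (heq _ _ (hg ⟨t x, mem_range_self x⟩))
  exact ⟨σ, fun m hm => key (Sum.inl ⟨m, hm⟩), funext fun x => key (Sum.inr x)⟩

end TypeDefinable

/-! ### Ramsey's theorem through a nonprincipal ultrafilter -/

section Ramsey

open Filter

/-- A predicate on `n`-tuples of natural numbers is large if it holds for all increasing tuples
whose first entry avoids an ultrafilter-small set, and in which every later entry avoids
ultrafilter-small sets depending on each of the earlier ones. -/
def Large {n : ℕ} (P : (Fin n → ℕ) → Prop) : Prop :=
  ∃ (C : Set ℕ) (B : ℕ → Set ℕ), C ∈ hyperfilter ℕ ∧ (∀ x, B x ∈ hyperfilter ℕ) ∧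
    ∀ v : Fin n → ℕ, (∀ i, v i ∈ C) → (∀ i j, i < j → v i < v j ∧ v j ∈ B (v i)) → P v

/-- The large sets for the individual first entries `i` are combined by a diagonal intersection,
which is possible since only the finitely many `i` below an entry `x` constrain what follows `x`. -/
theorem large_of_cons {n : ℕ} {P : (Fin (n + 1) → ℕ) → Prop}
    (h : {i | Large fun v : Fin n → ℕ => P (Fin.cons i v)} ∈ hyperfilter ℕ) : Large P := by
  classical
  have key : ∀ i, ∃ (C : Set ℕ) (B : ℕ → Set ℕ), C ∈ hyperfilter ℕ ∧
      (∀ x, B x ∈ hyperfilter ℕ) ∧ (Large (fun v : Fin n → ℕ => P (Fin.cons i v)) →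
        ∀ v : Fin n → ℕ, (∀ i, v i ∈ C) → (∀ i j, i < j → v i < v j ∧ v j ∈ B (v i)) →
          P (Fin.cons i v)) := by
    intro i
    by_cases hi : Large fun v : Fin n → ℕ => P (Fin.cons i v)
    · obtain ⟨C, B, h1, h2, h3⟩ := hi
      exact ⟨C, B, h1, h2, fun _ => h3⟩
    · exact ⟨univ, fun _ => univ, univ_mem, fun _ => univ_mem, fun h => absurd h hi⟩
  choose C B hC hB hP using key
  refine ⟨_, fun x => C x ∩ ⋂ i ∈ Finset.range (x + 1), B i x, h, fun x => inter_mem (hC x)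
    ((biInter_finset_mem _).2 fun i _ => hB i x), fun v hv hinc => ?_⟩
  rw [← Fin.cons_self_tail v]
  refine hP (v 0) (hv 0) (Fin.tail v) (fun i => (hinc 0 i.succ (Fin.succ_pos i)).2.1)
    fun i j hij => ⟨(hinc _ _ (Fin.succ_lt_succ_iff.2 hij)).1, ?_⟩
  have := (hinc _ _ (Fin.succ_lt_succ_iff.2 hij)).2.2
  rw [mem_iInter₂] at this
  refine this (v 0) (Finset.mem_range.2 (Nat.lt_succ_of_lt (hinc 0 i.succ (Fin.succ_pos i)).1))

theorem large_or_large_not {n : ℕ} (P : (Fin n → ℕ) → Prop) : Large P ∨ Large fun v => ¬ P v := by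
  induction n with
  | zero =>
    by_cases h : P Fin.elim0
    · exact Or.inl ⟨univ, fun _ => univ, univ_mem, fun _ => univ_mem, fun v _ _ => by
        rwa [Subsingleton.elim v Fin.elim0]⟩
    · exact Or.inr ⟨univ, fun _ => univ, univ_mem, fun _ => univ_mem, fun v _ _ => by
        rwa [Subsingleton.elim v Fin.elim0]⟩
  | succ n ih =>
    rcases (hyperfilter ℕ).mem_or_compl_mem {i | Large fun v : Fin n → ℕ => P (Fin.cons i v)}
      with h | h
    · exact Or.inl (large_of_cons h)
    · refine Or.inr (large_of_cons (mem_of_superset h fun i hi => ?_))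
      exact (ih _).resolve_left hi

theorem large_of_forall {n : ℕ} {P : (Fin n → ℕ) → Prop} (h : ∀ v, StrictMono v → P v) : Large P :=
  ⟨univ, fun _ => univ, univ_mem, fun _ => univ_mem,
    fun v _ hv => h v fun _ _ hij => (hv _ _ hij).1⟩

/-- Finitely many large predicates hold simultaneously on all increasing tuples from some infinite
set. Together with `large_or_large_not` this is the infinite Ramsey theorem. -/
theorem exists_strictMono_of_large {ι : Type*} [Finite ι] {n : ι → ℕ}
    {P : ∀ i, (Fin (n i) → ℕ) → Prop} (h : ∀ i, Large (P i)) :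
    ∃ f : ℕ → ℕ, StrictMono f ∧ ∀ i, ∀ s : Fin (n i) → ℕ, StrictMono s → P i (f ∘ s) := by
  choose C B hC hB hP using h
  obtain ⟨f, hf, hr⟩ := exists_seq_of_forall_finset_exists (fun y => y ∈ ⋂ i, C i)
    (fun x y => x < y ∧ y ∈ ⋂ i, B i x) (fun s _ => by
      have h1 : (⋂ i, C i) ∩ ⋂ x ∈ s, (Ioi x ∩ ⋂ i, B i x) ∈ hyperfilter ℕ :=
        inter_mem (iInter_mem.2 hC) ((biInter_finset_mem s).2 fun x _ =>
          inter_mem (Nat.hyperfilter_le_atTop (Ioi_mem_atTop x)) (iInter_mem.2 fun i => hB i x))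
      obtain ⟨y, hy1, hy2⟩ := (hyperfilter ℕ).nonempty_of_mem h1
      exact ⟨y, hy1, fun x hx => mem_iInter₂.1 hy2 x hx⟩)
  refine ⟨f, fun m n hmn => (hr m n hmn).1, fun i s hs => hP i _ (fun k => ?_) fun k l hkl => ?_⟩
  · exact mem_iInter.1 (hf _) i
  · have := hr _ _ (hs hkl)
    exact ⟨this.1, mem_iInter.1 this.2 i⟩

end Ramsey

/-! ### Indiscernible sequences -/

variable (L) in
/-- Indiscernibility over a set `A` of parameters, phrased with `A`-definable sets. -/
def IndiscOver (A : Set M) {J α : Type*} [LinearOrder J] (a : J → α → M) : Prop :=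
  ∀ (n : ℕ) (s t : Fin n ↪o J) (D : Set (Fin n × α → M)), A.Definable L D →
    ((fun p => a (s p.1) p.2) ∈ D ↔ (fun p => a (t p.1) p.2) ∈ D)

theorem card_filter_lt_strictMonoOn {J : Type*} [LinearOrder J] (T : Finset J) :
    StrictMonoOn (fun j => (T.filter (· < j)).card) T := by
  intro i hi j hj hij
  refine Finset.card_lt_card ⟨fun k hk => ?_, fun h => ?_⟩
  · rw [Finset.mem_filter] at hk ⊢
    exact ⟨hk.1, hk.2.trans hij⟩
  · have := h (Finset.mem_filter.2 ⟨hi, hij⟩)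
    exact lt_irrefl i (Finset.mem_filter.1 this).2

/-- Every sequence of length `ω` has an indiscernible sequence of any prescribed small order type
that satisfies all definable conditions true of all increasing tuples of the given sequence. -/
theorem IsMonster.exists_indiscOver [Nonempty M] (hM : IsMonster L κ M) {A : Set M} (hA : #A < κ)
    {α : Type w} (hα : #α < κ) (x : ℕ → α → M) {J : Type w} [LinearOrder J] (hJ : #J < κ) :
    ∃ a : J → α → M, IndiscOver L A a ∧ ∀ (n : ℕ) (D : Set (Fin n × α → M)), A.Definable L D →
      (∀ v : Fin n → ℕ, StrictMono v → (fun p => x (v p.1) p.2) ∈ D) →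
        ∀ s : Fin n ↪o J, (fun p => a (s p.1) p.2) ∈ D := by
  classical
  let Q : (n : ℕ) → Set (Fin n × α → M) → (Fin n → ℕ) → Prop :=
    fun n D v => (fun p => x (v p.1) p.2) ∈ D
  obtain ⟨g, hg⟩ := hM.sInter_nonempty hA (V := J × α) (hM.mk_prod_lt hJ hα)
    (F := {D' | ∃ (n : ℕ) (D : Set (Fin n × α → M)) (s : Fin n ↪o J), A.Definable L D ∧
      Large (Q n D) ∧ D' = {g : J × α → M | (fun p : Fin n × α => g (s p.1, p.2)) ∈ D}})
    (by
      rintro _ ⟨n, D, s, hD, -, rfl⟩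
      exact hD.preimage_comp (fun p : Fin n × α => (s p.1, p.2)))
    (fun G hG hfin => by
      choose n D s hD hlarge heq using fun D' : G => hG D'.2
      have := hfin.to_subtype
      have := Fintype.ofFinite G
      obtain ⟨f, -, hf⟩ := exists_strictMono_of_large hlarge
      -- the finitely many indices that occur are mapped to `ℕ` by their rank
      let T : Finset J := Finset.univ.biUnion fun D' : G => Finset.univ.image (s D')
      refine ⟨fun p => x (f (T.filter (· < p.1)).card) p.2, fun D' hD' => ?_⟩
      change _ ∈ ((⟨D', hD'⟩ : G) : Set (J × α → M))
      rw [heq ⟨D', hD'⟩]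
      refine hf ⟨D', hD'⟩ (fun k => (T.filter (· < s ⟨D', hD'⟩ k)).card) fun k l hkl => ?_
      have hmem : ∀ k, s ⟨D', hD'⟩ k ∈ T := fun k => Finset.mem_biUnion.2
        ⟨_, Finset.mem_univ _, Finset.mem_image.2 ⟨k, Finset.mem_univ _, rfl⟩⟩
      exact card_filter_lt_strictMonoOn T (hmem k) (hmem l) ((s ⟨D', hD'⟩).strictMono hkl))
  have key : ∀ (n : ℕ) (D : Set (Fin n × α → M)), A.Definable L D → Large (Q n D) →
      ∀ s : Fin n ↪o J, (fun p : Fin n × α => g (s p.1, p.2)) ∈ D := fun n D hD hl s =>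
    hg _ ⟨n, D, s, hD, hl, rfl⟩
  refine ⟨fun j i => g (j, i), fun n s t D hD => ?_, fun n D hD h s =>
    key n D hD (large_of_forall h) s⟩
  rcases large_or_large_not (Q n D) with h | h
  · exact iff_of_true (key n D hD h s) (key n D hD h t)
  · exact iff_of_false (key n Dᶜ hD.compl h s) (key n Dᶜ hD.compl h t)

/-- Two small families of terms of an indiscernible sequence, with indices in the same order, are
conjugate. -/
theorem IndiscOver.exists_aut (hM : IsMonster L κ M) {A : Set M} (hA : #A < κ)
    {α : Type w} (hα : #α < κ) {J : Type*} [LinearOrder J] {a : J → α → M} (ha : IndiscOver L A a)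
    {ι : Type w} (hι : #ι < κ) (u u' : ι → J) (h : ∀ x y, u x < u y ↔ u' x < u' y) :
    ∃ σ : M ≃[L] M, (∀ m ∈ A, σ m = m) ∧ ∀ x, σ ∘ a (u x) = a (u' x) := by
  classical
  obtain ⟨σ, hσ, hσ'⟩ := hM.exists_aut hA (V := ι × α) (hM.mk_prod_lt hι hα)
    (fun p => a (u p.1) p.2) (fun p => a (u' p.1) p.2) (fun D hD => by
      obtain ⟨F, hF⟩ := exists_finset_support hD
      rcases F.eq_empty_or_nonempty with rfl | ⟨p₀, hp₀⟩
      · exact hF _ _ (by simp)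
      let T : Finset J := F.image fun p => u p.1
      have hT : ∀ j ∈ T, ∃ x, u x = j := fun j hj => by
        obtain ⟨p, -, rfl⟩ := Finset.mem_image.1 hj
        exact ⟨p.1, rfl⟩
      let e := T.orderEmbOfFin rfl
      -- `e` and `e'` enumerate increasingly the values of `u` and `u'` that matter
      choose c hc using fun k => hT (e k) (T.orderEmbOfFin_mem rfl k)
      let e' : Fin T.card ↪o J := OrderEmbedding.ofStrictMono (fun k => u' (c k)) fun k l hkl => by
        rw [← h, hc, hc]
        exact e.strictMono hkl
      have hρ : ∀ x, ∃ k, (u x ∈ T → e k = u x) := fun x => by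
        by_cases hx : u x ∈ T
        · have : u x ∈ range e := by
            rw [Finset.range_orderEmbOfFin]; exact hx
          obtain ⟨k, hk⟩ := this
          exact ⟨k, fun _ => hk⟩
        · exact ⟨⟨0, Finset.card_pos.2 ⟨_, Finset.mem_image_of_mem _ hp₀⟩⟩, fun h => absurd h hx⟩
      choose ρ hρ using hρ
      have h1 := ha _ e e' _ (hD.preimage_comp (β := Fin T.card × α) fun p => (ρ p.1, p.2))
      have hmem : ∀ p ∈ F, u p.1 ∈ T := fun p hp => Finset.mem_image_of_mem (fun p => u p.1) hp
      refine (hF _ _ fun p hp => ?_).trans (h1.trans (hF _ _ fun p hp => ?_))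
      · show a (u p.1) p.2 = a (e (ρ p.1)) p.2
        rw [hρ _ (hmem p hp)]
      · show a (u' (c (ρ p.1))) p.2 = a (u' p.1) p.2
        have hu : u (c (ρ p.1)) = u p.1 := by rw [hc, hρ _ (hmem p hp)]
        have : u' (c (ρ p.1)) = u' p.1 := le_antisymm
          (not_lt.1 fun hlt => ((h _ _).2 hlt).ne hu.symm)
          (not_lt.1 fun hlt => ((h _ _).2 hlt).ne hu)
        rw [this])
  exact ⟨σ, hσ, fun x => funext fun i => congrFun hσ' (x, i)⟩

/-! ### Counting definable sets -/

theorem IsMonster.mk_definable_lt (hM : IsMonster L κ M) {A : Set M} (hA : #A < κ)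
    {V : Type w} (hV : #V < κ) : #{D : Set (V → M) // A.Definable L D} < κ := by
  let f : L.Formula (A ⊕ V) → {D : Set (V → M) // A.Definable L D} := fun φ =>
    ⟨{v | φ.Realize (Sum.elim (fun a : A => (a : M)) v)},
      definable_iff_exists_formula_sum.2 ⟨φ, rfl⟩⟩
  have hf : Function.Surjective f := fun ⟨D, hD⟩ => by
    obtain ⟨φ, rfl⟩ := definable_iff_exists_formula_sum.1 hD
    exact ⟨φ, rfl⟩
  have h1 := lift_mk_le_lift_mk_of_surjective hf
  have h2 : #(L.Formula (A ⊕ V)) ≤ #(Σ n, L.BoundedFormula (A ⊕ V) n) :=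
    mk_le_of_injective (f := fun φ : L.Formula (A ⊕ V) => ⟨0, φ⟩) fun φ ψ h =>
      eq_of_heq (Sigma.mk.inj h).2
  have h3 := h2.trans BoundedFormula.card_le
  have h4 : #(L.Formula (A ⊕ V)) < lift.{max u v} κ := by
    refine h3.trans_lt (max_lt (aleph0_lt_lift.2 hM.aleph0_lt)
      (add_lt_of_lt (aleph0_le_lift.2 hM.aleph0_lt.le) (lift_lt.2 ?_) hM.card_lt))
    exact hM.mk_sum_lt hA hV
  have h5 := h1.trans_lt (lift_lt.2 h4)
  simpa using h5

/-! ### Bounded hyperdefinable sets -/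

section Bounded

variable {A : Set M} {α : Type w} {X : Set (α → M)} {E : Setoid X}

/-- The equivalence relation `E` as a set of concatenated pairs of tuples. -/
def relSet (E : Setoid X) : Set (α ⊕ α → M) :=
  {p | ∃ x y : X, E x y ∧ p = Sum.elim (x : α → M) (y : α → M)}

theorem mem_relSet {x y : α → M} :
    Sum.elim x y ∈ relSet E ↔ ∃ (hx : x ∈ X) (hy : y ∈ X), E ⟨x, hx⟩ ⟨y, hy⟩ := by
  constructor
  · rintro ⟨x', y', h, heq⟩
    obtain rfl : x = x' := funext fun i => congrFun heq (Sum.inl i)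
    obtain rfl : y = y' := funext fun i => congrFun heq (Sum.inr i)
    exact ⟨x'.2, y'.2, h⟩
  · rintro ⟨hx, hy, h⟩
    exact ⟨_, _, h, rfl⟩

theorem coe_mem_relSet {x y : X} : Sum.elim (x : α → M) y ∈ relSet E ↔ E x y := by
  simp [mem_relSet]

theorem relSet_symm {x y : α → M} (h : Sum.elim x y ∈ relSet E) : Sum.elim y x ∈ relSet E := by
  obtain ⟨hx, hy, h⟩ := mem_relSet.1 h
  exact mem_relSet.2 ⟨hy, hx, E.symm h⟩

theorem relSet_trans {x y z : α → M} (h : Sum.elim x y ∈ relSet E) (h' : Sum.elim y z ∈ relSet E) :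
    Sum.elim x z ∈ relSet E := by
  obtain ⟨hx, hy, h⟩ := mem_relSet.1 h
  obtain ⟨_, hz, h'⟩ := mem_relSet.1 h'
  exact mem_relSet.2 ⟨hx, hz, E.trans h h'⟩

theorem IsHyperdefinable.typeDefinable_relSet (hE : IsHyperdefinable L A X E) :
    TypeDefinable L A (relSet E) := hE.typeDefinable_rel

/-- Every definable neighbourhood of `E` contains the triple composite of another one. -/
theorem IsHyperdefinable.exists_comp [Nonempty M] (hM : IsMonster L κ M) (hA : #A < κ)
    (hα : #α < κ) (hE : IsHyperdefinable L A X E) {D₀ : Set (α ⊕ α → M)}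
    (hD₀ : D₀ ∈ DefNhds L A (relSet E)) :
    ∃ D ∈ DefNhds L A (relSet E), ∀ x y z t : α → M, Sum.elim y x ∈ D → Sum.elim y z ∈ D →
      Sum.elim z t ∈ D → Sum.elim x t ∈ D₀ := by
  let f : Fin 4 → Fin 4 → α ⊕ α → Fin 4 × α := fun j k =>
    Sum.elim (fun i => (j, i)) (fun i => (k, i))
  have hf : ∀ (v : Fin 4 × α → M) (j k : Fin 4),
      v ∘ f j k = Sum.elim (fun i => v (j, i)) (fun i => v (k, i)) := fun v j k => Sum.comp_elim ..
  obtain ⟨D, hD, h⟩ := hM.exists_nhds hA (V := Fin 4 × α) (hM.mk_fin_prod_lt 4 hα)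
    (J := Fin 3) (f := ![f 1 0, f 1 2, f 2 3]) hE.typeDefinable_relSet
    (T := (fun v : Fin 4 × α → M => v ∘ f 0 3) ⁻¹' D₀ᶜ)
    (TypeDefinable.preimage_comp _ (typeDefinable_of_definable hD₀.1.compl)) (fun v hv h => by
      refine hv (hD₀.2 ?_)
      have h0 : v ∘ f 1 0 ∈ relSet E := h 0
      have h1 : v ∘ f 1 2 ∈ relSet E := h 1
      have h2 : v ∘ f 2 3 ∈ relSet E := h 2
      change v ∘ f 0 3 ∈ relSet E
      rw [hf] at h0 h1 h2 ⊢
      exact relSet_trans (relSet_trans (relSet_symm h0) h1) h2)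
  refine ⟨D, hD, fun x y z t h0 h1 h2 => ?_⟩
  by_contra hcon
  refine h (fun p => ![x, y, z, t] p.1 p.2) ?_ fun j => ?_
  · rw [mem_preimage, hf]; exact hcon
  · fin_cases j
    · change _ ∘ f 1 0 ∈ D
      rw [hf]; exact h0
    · change _ ∘ f 1 2 ∈ D
      rw [hf]; exact h1
    · change _ ∘ f 2 3 ∈ D
      rw [hf]; exact h2

/-- The order embedding of `Fin 2` given by two comparable elements. -/
def pairEmb {J : Type*} [LinearOrder J] {i j : J} (h : i < j) : Fin 2 ↪o J :=
  OrderEmbedding.ofStrictMono ![i, j] (by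
    intro k l hkl
    fin_cases k <;> fin_cases l <;> simp_all)

theorem definable_pair {D : Set (α ⊕ α → M)} (hD : A.Definable L D) :
    A.Definable L {g : Fin 2 × α → M | Sum.elim (fun i => g (0, i)) (fun i => g (1, i)) ∈ D} := by
  convert! hD.preimage_comp
    (Sum.elim (fun i => (0, i)) (fun i => (1, i)) : α ⊕ α → Fin 2 × α) using 1
  ext g
  rw [mem_preimage, Sum.comp_elim]
  rfl

/-- An infinite sequence in `X` of pairwise separated points gives indiscernible sequences
of such points, of any small order type. -/
theorem IsMonster.exists_indiscOver_separated [Nonempty M] (hM : IsMonster L κ M) (hA : #A < κ)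
    (hα : #α < κ) (hX : TypeDefinable L A X) {D : Set (α ⊕ α → M)} (hD : A.Definable L D)
    {x : ℕ → α → M} (hx : ∀ n, x n ∈ X) (hxD : ∀ m n, m < n → Sum.elim (x m) (x n) ∉ D)
    {J : Type w} [LinearOrder J] (hJ : #J < κ) :
    ∃ a : J → α → M, IndiscOver L A a ∧ (∀ j, a j ∈ X) ∧ ∀ i j, i < j →
      Sum.elim (a i) (a j) ∉ D := by
  obtain ⟨a, ha, hEM⟩ := hM.exists_indiscOver hA hα x hJ
  refine ⟨a, ha, fun j => hX.mem_iff.2 fun D' hD' => ?_, fun i j hij => ?_⟩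
  · exact hEM 1 _ (hD'.1.preimage_comp (β := Fin 1 × α) fun i => (0, i))
      (fun v _ => hD'.2 (hx (v 0)))
      (OrderEmbedding.ofStrictMono (fun _ => j) (Subsingleton.strictMono _))
  · exact hEM 2 _ (definable_pair hD).compl (fun v hv => hxD _ _ (hv (by simp))) (pairEmb hij)

/-- A bounded hyperdefinable set has no infinite uniformly separated sequence. -/
theorem IsBoundedRel.not_separated [Nonempty M] (hM : IsMonster L κ M) (hA : #A < κ)
    (hα : #α < κ) (hX : TypeDefinable L A X) (hb : IsBoundedRel κ E) {D : Set (α ⊕ α → M)}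
    (hD : D ∈ DefNhds L A (relSet E)) {x : ℕ → α → M} (hx : ∀ n, x n ∈ X)
    (hxD : ∀ m n, m < n → Sum.elim (x m) (x n) ∉ D) : False := by
  let J := (Order.succ #(Quotient E)).ord.ToType
  have hJ : #J = Order.succ #(Quotient E) := mk_ord_toType _
  obtain ⟨a, -, haX, haD⟩ := hM.exists_indiscOver_separated hA hα hX hD.1 hx hxD (J := J)
    (hJ ▸ hM.isStrongLimit.isSuccLimit.succ_lt hb)
  have hinj : Function.Injective fun j => Quotient.mk E ⟨a j, haX j⟩ := by
    have : ∀ i j, i < j → Quotient.mk E ⟨a i, haX i⟩ ≠ Quotient.mk E ⟨a j, haX j⟩ :=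
      fun i j hij h => haD i j hij (hD.2 (coe_mem_relSet.2 (Quotient.exact h)))
    intro i j hij
    rcases lt_trichotomy i j with h | h | h
    · exact absurd hij (this i j h)
    · exact h
    · exact absurd hij.symm (this j i h)
  have := mk_le_of_injective hinj
  rw [hJ] at this
  exact this.not_gt (Order.lt_succ _)

/-- A bounded hyperdefinable set is covered by finitely many translates of any definable
neighbourhood of the equivalence relation. -/
theorem IsBoundedRel.exists_cover [Nonempty M] (hM : IsMonster L κ M) (hA : #A < κ)
    (hα : #α < κ) (hX : TypeDefinable L A X) (hb : IsBoundedRel κ E) {D : Set (α ⊕ α → M)}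
    (hD : D ∈ DefNhds L A (relSet E)) :
    ∃ T : Finset X, ∀ x : X, ∃ t ∈ T, Sum.elim (t : α → M) x ∈ D := by
  by_contra! hcon
  obtain ⟨f, -, hf⟩ := exists_seq_of_forall_finset_exists (fun _ : X => True)
    (fun t x => Sum.elim (t : α → M) x ∉ D) (fun s _ => by simpa using hcon s)
  exact hb.not_separated hM hA hα hX hD (x := fun n => f n) (fun n => (f n).2) hf

/-- If every definable neighbourhood of `E` covers `X` by finitely many translates, then `E` is
bounded: a class is determined by the translates that it meets. -/
theorem IsHyperdefinable.isBoundedRel [Nonempty M] (hM : IsMonster L κ M) (hA : #A < κ)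
    (hα : #α < κ) (hE : IsHyperdefinable L A X E)
    (h : ∀ D ∈ DefNhds L A (relSet E),
      ∃ T : Finset X, ∀ x : X, ∃ t ∈ T, Sum.elim (t : α → M) x ∈ D) : IsBoundedRel κ E := by
  choose T hT using h
  let f : Quotient E → Set (Σ D : DefNhds L A (relSet E), T D D.2) := fun c =>
    {p | Sum.elim (p.2.1 : α → M) c.out ∈ p.1.1}
  have hf : Function.Injective f := by
    intro c c' hcc
    rw [← Quotient.out_eq c, ← Quotient.out_eq c']
    refine Quotient.sound (coe_mem_relSet.1 (hE.typeDefinable_relSet.mem_iff.2 fun D₀ hD₀ => ?_))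
    obtain ⟨D, hD, hcomp⟩ := hE.exists_comp hM hA hα hD₀
    obtain ⟨t, ht, htD⟩ := hT D hD c.out
    have h1 : (⟨⟨D, hD⟩, ⟨t, ht⟩⟩ : Σ D : DefNhds L A (relSet E), T D D.2) ∈ f c := htD
    rw [hcc] at h1
    exact hcomp _ t c'.out _ htD h1 (hD.2 (coe_mem_relSet.2 (E.refl _)))
  refine (mk_le_of_injective hf).trans_lt ?_
  rw [mk_set]
  refine hM.isStrongLimit.isStrongPrelimit ?_
  rw [mk_sigma]
  refine (sum_le_sum _ (fun _ => ℵ₀) fun D => mk_le_aleph0).trans_lt ?_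
  rw [sum_const']
  refine mul_lt_of_lt hM.aleph0_lt.le ?_ hM.aleph0_lt
  refine (mk_subtype_mono fun D hD => hD.1).trans_lt (hM.mk_definable_lt hA (hM.mk_sum_lt hα hα))

/-- The image of a representative of `c` represents the image of `c`. -/
theorem MapsClass.mem_relSet (hE : IsHyperdefinable L A X E) {σ : M ≃[L] M}
    (hσ : ∀ m ∈ A, σ m = m) {c c' : Quotient E} (h : MapsClass L σ c c') {x x' : X}
    (hx : Quotient.mk E x = c) (hx' : Quotient.mk E x' = c') :
    Sum.elim (σ ∘ (x : α → M)) x' ∈ relSet E := by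
  obtain ⟨y, y', rfl, rfl, hy⟩ := h
  refine relSet_trans (y := (y' : α → M)) ?_ (coe_mem_relSet.2 (Quotient.exact hx'.symm))
  rw [← show σ ∘ (y : α → M) = y' from funext hy, ← Sum.comp_elim]
  exact (aut_mem_iff_of_typeDefinable hE.typeDefinable_relSet σ hσ _).2
    (coe_mem_relSet.2 (Quotient.exact hx))

/-- An indiscernible sequence in a bounded hyperdefinable set is constant. -/
theorem IsBoundedRel.eq_of_indiscernible [Nonempty M] (hM : IsMonster L κ M) (hA : #A < κ)
    (hα : #α < κ) (hE : IsHyperdefinable L A X E) (hb : IsBoundedRel κ E) {β : Type w}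
    {c : ℕ → Quotient E} {b : ℕ → β → M} (h : IsIndiscernibleHyp L A c b) {k l : ℕ} (hkl : k < l) :
    c k = c l := by
  by_contra hne
  have hnot : Sum.elim ((c k).out : α → M) (c l).out ∉ relSet E := fun hmem =>
    hne (by simpa using Quotient.sound (coe_mem_relSet.1 hmem))
  rw [hE.typeDefinable_relSet.mem_iff] at hnot
  push Not at hnot
  obtain ⟨D₀, hD₀, hnot⟩ := hnot
  obtain ⟨D, hD, hcomp⟩ := hE.exists_comp hM hA hα hD₀
  refine hb.not_separated hM hA hα hE.typeDefinable_set hD (x := fun n => (c n).out)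
    (fun n => (c n).out.2) fun m n hmn hmem => hnot ?_
  obtain ⟨σ, hσ, hσc⟩ := h 2 (pairEmb hkl) (pairEmb hmn)
  rw [← aut_mem_iff hD₀.1 σ hσ, Sum.comp_elim]
  refine hcomp _ (c m).out (c n).out _ (hD.2 (relSet_symm ?_)) hmem (hD.2 (relSet_symm ?_))
  · exact (hσc 0).1.mem_relSet hE hσ (Quotient.out_eq _) (Quotient.out_eq _)
  · exact (hσc 1).1.mem_relSet hE hσ (Quotient.out_eq _) (Quotient.out_eq _)

theorem IsBoundedRel.isStable [Nonempty M] (hM : IsMonster L κ M) (hA : #A < κ)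
    (hα : #α < κ) (hE : IsHyperdefinable L A X E) (hb : IsBoundedRel κ E) : IsStable L κ A E := by
  intro β hβ c b h i j hij
  have hc : c i = c j := by
    rcases lt_or_gt_of_ne hij with hlt | hlt
    · exact hb.eq_of_indiscernible hM hA hα hE h hlt
    · exact (hb.eq_of_indiscernible hM hA hα hE h hlt).symm
  obtain ⟨σ, hσ, hσ'⟩ := h 1 (OrderEmbedding.ofStrictMono (fun _ => j) (Subsingleton.strictMono _))
    (OrderEmbedding.ofStrictMono (fun _ => i) (Subsingleton.strictMono _))
  refine ⟨σ, hσ, fun _ => ⟨?_, (hσ' 0).2⟩⟩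
  have := (hσ' 0).1
  simp only [Function.comp_apply, OrderEmbedding.coe_ofStrictMono, hc] at this ⊢
  exact this

end Bounded

/-! ### Distality for infinite tuples and over parameters -/

/-- A formula about a sequence of tuples mentions only finitely many coordinates of the tuples, so
that it can be rewritten for the sequence of the corresponding finite tuples. -/
theorem exists_formula_fin {γ : Type*} {n : ℕ} (φ : L.Formula (Fin n × γ)) :
    ∃ (m : ℕ) (e : Fin m → γ) (ψ : L.Formula (Fin n × Fin m)),
      ∀ v : Fin n × γ → M, φ.Realize v ↔ ψ.Realize fun p => v (p.1, e p.2) := by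
  classical
  let F : Finset γ := φ.freeVarFinset.image Prod.snd
  refine ⟨F.card, fun k => F.equivFin.symm k, φ.restrictFreeVar fun p =>
    (p.1.1, F.equivFin ⟨p.1.2, Finset.mem_image_of_mem _ p.2⟩), fun v => ?_⟩
  exact (BoundedFormula.realize_restrictFreeVar _ (by simp)).symm

theorem isIndiscernible_comp {I : Type w} [LinearOrder I] {γ δ : Type*} {a : I → γ → M}
    (ha : IsIndiscernible L a) (e : δ → γ) : IsIndiscernible L fun i => a i ∘ e := by
  intro n s t φ
  have := ha n s t (φ.relabel fun p => (p.1, e p.2))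
  simp only [Formula.realize_relabel] at this
  exact this

theorem comp_concat {I J : Type w} {Z Z' : Type*} (F : Z → Z') (a : I → Z) (b : J → Z) :
    (fun x => F (concat a b x)) = concat (fun i => F (a i)) (fun j => F (b j)) := by
  funext x
  rcases h : ofLex x with i | j <;> simp [concat, h]

/-- Distality passes from finite tuples to tuples of arbitrary length. -/
theorem IsDistal.isDistalSeq (hd : IsDistal L κ M) {I : Type w} [LinearOrder I] [DenselyOrdered I]
    (hI : #I < κ) {γ : Type*} {a : I → γ → M} (ha : IsIndiscernible L a) : IsDistalSeq L a := by
  intro C₁ C₂ h₁ h₂ h₁₂ b₁ b₂ hb₁ hb₂ n s t φ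
  obtain ⟨m, e, ψ, hψ⟩ := exists_formula_fin (M := M) φ
  rw [hψ, hψ]
  have key := hd I hI m (fun i => a i ∘ e) (isIndiscernible_comp ha e) C₁ C₂ h₁ h₂ h₁₂ (b₁ ∘ e)
    (b₂ ∘ e) (by
      have := isIndiscernible_comp hb₁ e
      rwa [comp_concat (fun z => z ∘ e), comp_concat (fun z => z ∘ e)] at this) (by
      have := isIndiscernible_comp hb₂ e
      rwa [comp_concat (fun z => z ∘ e), comp_concat (fun z => z ∘ e)] at this) n s t ψ
  have heq : ∀ (a' : I → γ → M), concat (restr (fun i => a' i ∘ e) C₁) (concat (single (b₁ ∘ e))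
        (concat (restr (fun i => a' i ∘ e) (C₂ \ C₁)) (concat (single (b₂ ∘ e))
          (restr (fun i => a' i ∘ e) C₂ᶜ)))) = fun x => concat (restr a' C₁) (concat (single b₁)
        (concat (restr a' (C₂ \ C₁)) (concat (single b₂) (restr a' C₂ᶜ)))) x ∘ e := fun a' => by
    rw [comp_concat (fun z => z ∘ e), comp_concat (fun z => z ∘ e), comp_concat (fun z => z ∘ e),
      comp_concat (fun z => z ∘ e)]
    rfl
  rw [heq] at key
  exact key

section Over

variable {A : Set M} {α : Type w}

/-- Indiscernibility over `A` is indiscernibility of the sequence with `A` added to each tuple. -/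
theorem indiscOver_iff {I : Type w} [LinearOrder I] {a : I → α → M} :
    IndiscOver L A a ↔ IsIndiscernible L fun i => Sum.elim (fun m : A => (m : M)) (a i) := by
  constructor
  · intro h n s t φ
    let g : Fin n × (A ⊕ α) → A ⊕ (Fin n × α) := fun p => p.2.elim Sum.inl fun i => Sum.inr (p.1, i)
    have := h n s t {v | (φ.relabel g).Realize (Sum.elim (fun m : A => (m : M)) v)}
      (definable_iff_exists_formula_sum.2 ⟨_, rfl⟩)
    simp only [mem_ofPred_eq, Formula.realize_relabel] at this
    convert this using 2
    all_goals
      ext ⟨k, m | i⟩ <;> rfl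
  · intro h n s t D hD
    obtain ⟨φ, rfl⟩ := definable_iff_exists_formula_sum.1 hD
    rcases n with _ | n
    · rw [show s = t from DFunLike.ext _ _ fun i => i.elim0]
    let g : A ⊕ (Fin (n + 1) × α) → Fin (n + 1) × (A ⊕ α) :=
      Sum.elim (fun m => (0, Sum.inl m)) fun p => (p.1, Sum.inr p.2)
    have := h (n + 1) s t (φ.relabel g)
    simp only [Formula.realize_relabel] at this
    change φ.Realize _ ↔ φ.Realize _
    convert this using 2
    all_goals
      ext (m | p) <;> rfl

theorem IndiscOver.comp {I J : Type*} [LinearOrder I] [LinearOrder J] {a : J → α → M}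
    (ha : IndiscOver L A a) {u : I → J} (hu : StrictMono u) : IndiscOver L A fun i => a (u i) :=
  fun n s t D hD => ha n (s.trans (OrderEmbedding.ofStrictMono u hu))
    (t.trans (OrderEmbedding.ofStrictMono u hu)) D hD

theorem IndiscOver.aut {I : Type*} [LinearOrder I] {a : I → α → M} (ha : IndiscOver L A a)
    (σ : M ≃[L] M) (hσ : ∀ m ∈ A, σ m = m) : IndiscOver L A fun i => σ ∘ a i := by
  intro n s t D hD
  exact (aut_mem_iff hD σ hσ _).trans ((ha n s t D hD).trans (aut_mem_iff hD σ hσ _).symm)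

/-- Distality for sequences that are indiscernible over a set of parameters. -/
theorem IsDistal.indiscOver (hd : IsDistal L κ M) {I : Type w} [LinearOrder I] [DenselyOrdered I]
    (hI : #I < κ) {a : I → α → M} (ha : IndiscOver L A a) {C₁ C₂ : Set I}
    (h₁ : IsDedekindCut C₁) (h₂ : IsDedekindCut C₂) (h₁₂ : C₁ ⊂ C₂) {b₁ b₂ : α → M}
    (hb₁ : IndiscOver L A (concat (restr a C₁) (concat (single b₁) (restr a C₁ᶜ))))
    (hb₂ : IndiscOver L A (concat (restr a C₂) (concat (single b₂) (restr a C₂ᶜ)))) :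
    IndiscOver L A (concat (restr a C₁) (concat (single b₁)
      (concat (restr a (C₂ \ C₁)) (concat (single b₂) (restr a C₂ᶜ))))) := by
  rw [indiscOver_iff] at ha hb₁ hb₂ ⊢
  rw [comp_concat, comp_concat] at hb₁ hb₂
  rw [comp_concat, comp_concat, comp_concat, comp_concat]
  exact hd.isDistalSeq hI ha C₁ C₂ h₁ h₂ h₁₂ (Sum.elim (fun m : A => (m : M)) b₁)
    (Sum.elim (fun m : A => (m : M)) b₂) hb₁ hb₂

end Over

/-! ### Stable hyperdefinable sets are bounded -/

/-- The index set of a sequence with two distinguished Dedekind cuts: three copies of `ℚ`. -/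
abbrev Blocks : Type w := ULift.{w} (Fin 3 ×ₗ ℚ)

/-- A sequence of copies of `ℚ` indexed by `ℕ∞`. -/
abbrev Line : Type w := ULift.{w} (ℕ∞ ×ₗ ℚ)

/-- The levels in `Line` used for the `i`-th place: `2i+1` for a single point, and `0`, `2i+2` and
`∞` for a copy of `Blocks`. -/
def level (i : ℕ) : Option (Fin 3) → ℕ∞
  | none => ((2 * i + 1 : ℕ) : ℕ∞)
  | some 0 => ((0 : ℕ) : ℕ∞)
  | some 1 => ((2 * i + 2 : ℕ) : ℕ∞)
  | some 2 => ⊤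

theorem level_lt_iff {i j i' j' : ℕ} (h : i < j ↔ i' < j') (h' : j < i ↔ j' < i')
    (x y : Option (Fin 3)) : level i x < level j y ↔ level i' x < level j' y := by
  rcases x with _ | x <;> rcases y with _ | y
  · simp only [level, Nat.cast_lt]; omega
  · fin_cases y <;> simp only [level, Nat.cast_lt, ENat.natCast_lt_top]; all_goals omega
  · fin_cases x <;> simp only [level, Nat.cast_lt, not_top_lt]; all_goals omega
  · fin_cases x <;> fin_cases y <;>
      simp only [level, Nat.cast_lt, ENat.natCast_lt_top, not_top_lt, lt_irrefl]
    all_goals omega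

theorem level_eq_iff {i j i' j' : ℕ} (h : i < j ↔ i' < j') (h' : j < i ↔ j' < i')
    (x y : Option (Fin 3)) : level i x = level j y ↔ level i' x = level j' y := by
  have h1 := level_lt_iff h h' x y
  have h2 := level_lt_iff h' h y x
  rw [← not_iff_not, ← ne_eq, ← ne_eq, ne_iff_lt_or_gt, ne_iff_lt_or_gt, h1, h2]

/-- The points of `Line` belonging to the `i`-th place. -/
def place (i : ℕ) : Option Blocks.{w} → Line.{w}
  | none => ⟨toLex (level i none, 0)⟩
  | some k => ⟨toLex (level i (some (ofLex k.down).1), (ofLex k.down).2)⟩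

/-- The order between points of `place i` and `place j` depends only on the order of `i`, `j`. -/
theorem place_lt_iff {i j i' j' : ℕ} (h : i < j ↔ i' < j') (h' : j < i ↔ j' < i')
    (x y : Option Blocks.{w}) : place i x < place j y ↔ place i' x < place j' y := by
  rcases x with _ | x <;> rcases y with _ | y <;>
    simp only [place, ULift.up_lt, Prod.Lex.toLex_lt_toLex, level_lt_iff h h', level_eq_iff h h']

theorem place_some_strictMono (i : ℕ) : StrictMono fun k : Blocks.{w} => place i (some k) := by
  rintro ⟨k⟩ ⟨l⟩ hkl
  rw [ULift.up_lt, Prod.Lex.lt_iff] at hkl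
  simp only [place, ULift.up_lt, Prod.Lex.toLex_lt_toLex]
  refine hkl.imp (fun h => ?_) fun h => ⟨by rw [h.1], h.2⟩
  generalize (ofLex k).1 = x, (ofLex l).1 = y at h
  fin_cases x <;> fin_cases y <;> first | exact absurd h (by decide) | skip
  · exact Nat.cast_lt.2 (Nat.succ_pos _)
  · exact ENat.natCast_lt_top _
  · exact ENat.natCast_lt_top _

instance : DenselyOrdered Blocks.{w} where
  dense := by
    rintro ⟨k⟩ ⟨l⟩ hkl
    obtain ⟨m, h1, h2⟩ := exists_between (ULift.up_lt.1 hkl)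
    exact ⟨⟨m⟩, h1, h2⟩

instance : Countable Blocks.{w} :=
  (ULift.down_injective.comp ofLex.injective).countable (β := Fin 3 × ℚ)

/-- The cut of `Blocks` to the left of the `n`-th copy of `ℚ`. -/
def blockCut (n : Fin 3) : Set Blocks.{w} := {k | (ofLex k.down).1 < n}

theorem isDedekindCut_blockCut {n : Fin 3} (hn : n ≠ 0) : IsDedekindCut (blockCut.{w} n) where
  isLowerSet := by
    rintro ⟨k⟩ ⟨l⟩ hlk hk
    exact (Prod.Lex.monotone_fst_ofLex hlk).trans_lt hk
  left_nonempty := ⟨⟨toLex (0, 0)⟩, Fin.pos_iff_ne_zero.2 hn⟩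
  left_noMax := by
    rintro ⟨k⟩ hk
    exact ⟨⟨toLex ((ofLex k).1, (ofLex k).2 + 1)⟩, hk, by
      rw [ULift.up_lt, Prod.Lex.lt_iff]; simp⟩
  right_nonempty := ⟨⟨toLex (n, 0)⟩, lt_irrefl n⟩
  right_noMin := by
    rintro ⟨k⟩ hk
    exact ⟨⟨toLex ((ofLex k).1, (ofLex k).2 - 1)⟩, hk, by
      rw [ULift.up_lt, Prod.Lex.lt_iff]; simp⟩

/-- A strictly increasing sequence stays so after insertion of a term into a cut. -/
theorem strictMono_concat {I : Type w} [LinearOrder I] {J : Type*} [LinearOrder J] {p : I → J}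
    (hp : StrictMono p) {C : Set I} {j : J} (hl : ∀ i ∈ C, p i < j)
    (hr : ∀ i ∉ C, j < p i) :
    StrictMono (concat (restr p C) (concat (single.{w} j) (restr p Cᶜ))) := by
  intro x y hxy
  induction x using Lex.rec with | _ x
  induction y using Lex.rec with | _ y
  rw [Sum.Lex.toLex_lt_toLex] at hxy
  rcases hxy with @⟨x, y, h⟩ | @⟨x, y, h⟩ | ⟨x, y⟩
  · exact hp h
  · induction x using Lex.rec with | _ x
    induction y using Lex.rec with | _ y
    rw [Sum.Lex.toLex_lt_toLex] at h
    rcases h with @⟨x, y, h⟩ | @⟨x, y, h⟩ | ⟨x, y⟩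
    · exact absurd h (lt_irrefl _)
    · exact hp h
    · exact hr y y.2
  · induction y using Lex.rec with | _ y
    rcases y with y | y
    · exact hl x x.2
    · exact (hl x x.2).trans (hr y y.2)

section Stable

variable {A : Set M} {α : Type w} {X : Set (α → M)} {E : Setoid X}

instance : Countable Line.{w} :=
  (ULift.down_injective.comp ofLex.injective).countable (β := ℕ∞ × ℚ)

theorem place_some_lt_place_none {i j : ℕ} {k : Blocks.{w}}
    (h : level i (some (ofLex k.down).1) < level j none) : place i (some k) < place j none :=
  Prod.Lex.toLex_lt_toLex.2 (Or.inl h)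

theorem place_none_lt_place_some {i j : ℕ} {k : Blocks.{w}}
    (h : level j none < level i (some (ofLex k.down).1)) : place j none < place i (some k) :=
  Prod.Lex.toLex_lt_toLex.2 (Or.inl h)

/-- Stability moves a class of the indiscernible sequence across one of the blocks: the class of
the point of index `1`, seen from the blocks `0`, `4`, `∞`, has the same type as the class of the
point of index `3`, seen from the blocks `0`, `2`, `∞`. -/
theorem IsStable.exists_aut_place (hM : IsMonster L κ M) (hA : #A < κ)
    (hα : #α < κ) (hs : IsStable L κ A E) {a : Line.{w} → α → M} (ha : IndiscOver L A a)
    (haX : ∀ j, a j ∈ X) : ∃ σ : M ≃[L] M, (∀ m ∈ A, σ m = m) ∧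
      MapsClass L σ (Quotient.mk E ⟨a (place 0 none), haX _⟩)
        (Quotient.mk E ⟨a (place 1 none), haX _⟩) ∧
      ∀ k : Blocks.{w}, σ ∘ a (place 1 (some k)) = a (place 0 (some k)) := by
  obtain ⟨σ, hσ, hσ'⟩ := hs (Blocks.{w} × α) (hM.mk_prod_lt hM.mk_lt_of_countable hα)
    (fun i => Quotient.mk E ⟨a (place i none), haX _⟩) (fun i p => a (place i (some p.1)) p.2)
    (fun n s t => by
      obtain ⟨σ, hσ, hσ'⟩ := ha.exists_aut hM hA hα (ι := ULift.{w} (Fin n) × Option Blocks.{w})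
        hM.mk_lt_of_countable (fun p => place (s p.1.down) p.2) (fun p => place (t p.1.down) p.2)
        (fun p q => place_lt_iff (by simp) (by simp) _ _)
      refine ⟨σ, hσ, fun k => ⟨⟨_, _, rfl, rfl, ?_⟩, ?_⟩⟩
      · exact fun i => congrFun (hσ' (⟨k⟩, none)) i
      · exact fun p => congrFun (hσ' (⟨k⟩, some p.1)) p.2) 0 1 zero_ne_one
  exact ⟨σ, hσ, (hσ' ()).1, fun k => funext fun i => (hσ' ()).2 (k, i)⟩

/-- In a distal theory, a stable hyperdefinable set is bounded. Otherwise there is an indiscernible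
sequence of separated representatives; by stability and distality, two terms of such a sequence
could be replaced by two representatives of the same class. -/
theorem IsStable.isBoundedRel [Nonempty M] (hM : IsMonster L κ M) (hd : IsDistal L κ M)
    (hA : #A < κ) (hα : #α < κ) (hE : IsHyperdefinable L A X E) (hs : IsStable L κ A E) :
    IsBoundedRel κ E := by
  refine hE.isBoundedRel hM hA hα fun D hD => ?_
  by_contra! hcon
  obtain ⟨f, -, hf⟩ := exists_seq_of_forall_finset_exists (fun _ : X => True)
    (fun t x => Sum.elim (t : α → M) x ∉ D) (fun s _ => by simpa using hcon s)
  obtain ⟨a, ha, haX, haD⟩ := hM.exists_indiscOver_separated hA hα hE.typeDefinable_set hD.1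
    (x := fun n => f n) (fun n => (f n).2) hf (J := Line.{w}) hM.mk_lt_of_countable
  obtain ⟨σ, hσ, hσc, hσb⟩ := hs.exists_aut_place hM hA hα ha haX
  -- a representative of the class of `a (place 1 none)`, namely `σ ∘ a (place 0 none)`, fills the
  -- left cut of `a'`, and `a (place 1 none)` itself fills the right one
  let a' : Blocks.{w} → α → M := fun k => a (place 0 (some k))
  have ha' : IndiscOver L A a' := ha.comp (place_some_strictMono 0)
  have hfill₁ : IndiscOver L A (concat (restr a' (blockCut 1))
      (concat (single (σ ∘ a (place 0 none))) (restr a' (blockCut 1)ᶜ))) := by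
    have hlt : ∀ x : Fin 3, (x < 1 → level 1 (some x) < level 0 none) ∧
        (¬ x < 1 → level 0 none < level 1 (some x)) := by
      intro x
      fin_cases x <;> refine ⟨fun h => ?_, fun h => ?_⟩ <;>
        first
        | exact absurd h (by decide)
        | exact ENat.natCast_lt_top _
        | exact Nat.cast_lt.2 (by decide)
    have := (ha.comp (strictMono_concat (place_some_strictMono 1) (C := blockCut 1)
      (j := place 0 none) (fun i hi => place_some_lt_place_none ((hlt _).1 hi))
      fun i hi => place_none_lt_place_some ((hlt _).2 hi))).aut σ hσ
    rw [comp_concat (fun j => σ ∘ a j), comp_concat (fun j => σ ∘ a j)] at this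
    convert! this using 2
    · exact funext fun k => (hσb k).symm
    · congr 1
      exact funext fun k => (hσb k).symm
  have hfill₂ : IndiscOver L A (concat (restr a' (blockCut 2))
      (concat (single (a (place 1 none))) (restr a' (blockCut 2)ᶜ))) := by
    have hlt : ∀ x : Fin 3, (x < 2 → level 0 (some x) < level 1 none) ∧
        (¬ x < 2 → level 1 none < level 0 (some x)) := by
      intro x
      fin_cases x <;> refine ⟨fun h => ?_, fun h => ?_⟩ <;>
        first
        | exact absurd h (by decide)
        | exact ENat.natCast_lt_top _
        | exact Nat.cast_lt.2 (by decide)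
    have := ha.comp (strictMono_concat (place_some_strictMono 0) (C := blockCut 2)
      (j := place 1 none) (fun i hi => place_some_lt_place_none ((hlt _).1 hi))
      fun i hi => place_none_lt_place_some ((hlt _).2 hi))
    rw [comp_concat a, comp_concat a] at this
    exact this
  have key := hd.indiscOver hM.mk_lt_of_countable ha' (isDedekindCut_blockCut one_ne_zero)
    (isDedekindCut_blockCut (n := 2) (by decide))
      ⟨fun k hk => lt_trans hk (by decide : (1 : Fin 3) < 2),
        fun h => absurd (h (show (⟨toLex (1, 0)⟩ : Blocks.{w}) ∈ blockCut 2 from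
          (by decide : (1 : Fin 3) < 2))) (lt_irrefl (1 : Fin 3))⟩
    hfill₁ hfill₂
  let k₀ : blockCut.{w} 1 := ⟨⟨toLex (0, 0)⟩, Fin.zero_lt_one⟩
  let k₁ : blockCut.{w} 1 := ⟨⟨toLex (0, 1)⟩, Fin.zero_lt_one⟩
  have hk : k₀ < k₁ := by
    change toLex ((0 : Fin 3), (0 : ℚ)) < toLex ((0 : Fin 3), (1 : ℚ))
    simp [Prod.Lex.toLex_lt_toLex]
  have h2 := key 2 (pairEmb (Sum.Lex.inr_lt_inr_iff.2 (Sum.Lex.inl_lt_inr PUnit.unit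
    (toLex (Sum.inr (toLex (Sum.inl PUnit.unit)))))))
    (pairEmb (Sum.Lex.inl_lt_inl_iff.2 hk)) _ (definable_pair hD.1)
  have h3 := h2.1 (hD.2 (hσc.mem_relSet hE hσ rfl rfl))
  exact haD _ _ (place_some_strictMono 0 hk) h3

end Stable

/-! ### Chains of neighbourhoods of the identity in a group -/

section Chains

variable {Γ : Type*} [Group Γ]

/-- A sequence of subsets of a group that contain the identity and satisfy
`(U (n + 1))⁻¹ * U (n + 1) ⊆ U n`. Its intersection is a subgroup. -/
structure IsNhdChain (U : ℕ → Set Γ) : Prop where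
  one_mem : ∀ n, 1 ∈ U n
  inv_mul_mem : ∀ n, ∀ x ∈ U (n + 1), ∀ y ∈ U (n + 1), x⁻¹ * y ∈ U n

namespace IsNhdChain

variable {U : ℕ → Set Γ}

theorem antitone (hU : IsNhdChain U) : Antitone U := antitone_nat_of_succ_le fun n x hx => by
  simpa using hU.inv_mul_mem n 1 (hU.one_mem _) x hx

theorem inv_mem (hU : IsNhdChain U) {n : ℕ} {x : Γ} (hx : x ∈ U (n + 1)) : x⁻¹ ∈ U n := by
  simpa using hU.inv_mul_mem n x hx 1 (hU.one_mem _)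

theorem mul_mem (hU : IsNhdChain U) {n : ℕ} {x y : Γ} (hx : x ∈ U (n + 2)) (hy : y ∈ U (n + 1)) :
    x * y ∈ U n := by
  simpa using hU.inv_mul_mem n x⁻¹ (hU.inv_mem hx) y hy

theorem prod_mem (hU : IsNhdChain U) {n : ℕ} (l : List Γ)
    (hl : ∀ x ∈ l, x ∈ U (n + 2 * l.length)) : l.prod ∈ U n := by
  induction l generalizing n with
  | nil => exact hU.one_mem n
  | cons x l ih =>
    rw [List.prod_cons]
    rw [List.forall_mem_cons, List.length_cons] at hl
    refine hU.mul_mem (hU.antitone (by omega) hl.1) (hU.antitone (Nat.le_succ _) (ih fun y hy => ?_))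
    exact hU.antitone (by omega) (hl.2 y hy)

/-- The subgroup that is the intersection of a chain. -/
def subgroup (hU : IsNhdChain U) : Subgroup Γ where
  carrier := ⋂ n, U n
  one_mem' := mem_iInter.2 hU.one_mem
  inv_mem' hx := mem_iInter.2 fun n => hU.inv_mem (mem_iInter.1 hx (n + 1))
  mul_mem' hx hy := mem_iInter.2 fun n =>
    hU.mul_mem (mem_iInter.1 hx (n + 2)) (mem_iInter.1 hy (n + 1))

theorem mem_subgroup (hU : IsNhdChain U) {x : Γ} : x ∈ hU.subgroup ↔ ∀ n, x ∈ U n := mem_iInter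

end IsNhdChain

/-- If the subgroups given by chains `U i`, whose members have uniformly finite covers by
translates, form an infinite strictly descending sequence of intersections, witnessed at the level
`0` of the chains, then the sets `U i 2` shatter finite sets of any size. Ramsey's theorem provides
quotients `d = c⁻¹ * c'` of the witnesses that lie in all but one of (a deep level of) the chains,
and products of these shatter. -/
theorem exists_shattered {U : ℕ → ℕ → Set Γ} (hU : ∀ i, IsNhdChain (U i)) {N : ℕ → ℕ}
    (hN : ∀ i n, ∃ T : Finset Γ, T.card ≤ N n ∧ ∀ g, ∃ t ∈ T, t⁻¹ * g ∈ U i n) {c : ℕ → Γ}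
    (hc : ∀ i, c i ∉ U i 0) (hc' : ∀ i j, i < j → ∀ n, c j ∈ U i n) (k : ℕ) :
    ∃ (i : Fin k → ℕ) (g : Set (Fin k) → Γ), ∀ l S, g S ∈ U (i l) 2 ↔ l ∈ S := by
  classical
  -- a product of at most `k` elements of `U i m` lies in `U i 4`
  let m := 4 + 2 * k
  obtain ⟨f, hf, hfU⟩ : ∃ f : ℕ → ℕ, StrictMono f ∧ ∀ s : Fin 3 → ℕ, StrictMono s →
      (c (f (s 0)))⁻¹ * c (f (s 1)) ∈ U (f (s 2)) m := by
    rcases large_or_large_not fun s : Fin 3 → ℕ => (c (s 0))⁻¹ * c (s 1) ∈ U (s 2) m with h | h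
    · obtain ⟨f, hf, h⟩ := exists_strictMono_of_large (ι := Unit) fun _ => h
      exact ⟨f, hf, h ()⟩
    · obtain ⟨f, hf, h⟩ := exists_strictMono_of_large (ι := Unit) fun _ => h
      exfalso
      -- among more elements than translates of `U j (m + 1)`, two lie in the same translate
      obtain ⟨T, hT, hcov⟩ := hN (f (N (m + 1) + 1)) (m + 1)
      choose t ht htU using hcov
      obtain ⟨p, hp, q, hq, hpq, heq⟩ := Finset.exists_ne_map_eq_of_card_lt_of_maps_to
        (s := Finset.range (N (m + 1) + 1)) (t := T) (f := fun p => t (c (f p)))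
        (by simpa using Nat.lt_succ_of_le hT) (fun p _ => ht _)
      have key : ∀ p q, p < q → q < N (m + 1) + 1 → t (c (f p)) = t (c (f q)) → False := by
        intro p q hpq hq heq
        refine h () ![p, q, N (m + 1) + 1] ?_ ?_
        · rw [Fin.strictMono_iff_lt_succ]
          intro i
          fin_cases i
          · exact hpq
          · exact hq
        · have h1 := htU (c (f p))
          have h2 := htU (c (f q))
          rw [← heq] at h2
          have := (hU _).inv_mul_mem m _ h1 _ h2
          rwa [mul_inv_rev, inv_inv, mul_assoc, mul_inv_cancel_left] at this
      rw [Finset.mem_range] at hp hq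
      rcases lt_or_gt_of_ne hpq with hlt | hlt
      · exact key p q hlt hq heq
      · exact key q p hlt hp heq.symm
  let d : Fin k → Γ := fun l => (c (f (2 * l)))⁻¹ * c (f (2 * l + 1))
  let e : Set (Fin k) → Fin k → Γ := fun S l => if l ∈ S then 1 else d l
  have hlt : ∀ S (l l' : Fin k), l' < l → e S l' ∈ U (f (2 * l)) m := by
    intro S l l' hl
    have hl' : (l' : ℕ) < l := hl
    simp only [e]
    split_ifs with hS
    · exact (hU _).one_mem _
    · refine hfU ![2 * l', 2 * l' + 1, 2 * l] ?_
      rw [Fin.strictMono_iff_lt_succ]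
      intro i
      fin_cases i
      · exact Nat.lt_succ_self _
      · change 2 * (l' : ℕ) + 1 < 2 * l
        omega
  have hgt : ∀ S (l l' : Fin k), l < l' → e S l' ∈ (hU (f (2 * l))).subgroup := by
    intro S l l' hl
    have hl' : (l : ℕ) < l' := hl
    simp only [e]
    split_ifs with hS
    · exact one_mem _
    · refine mul_mem (inv_mem ?_) ?_ <;> exact (hU _).mem_subgroup.2 (hc' _ _ (hf (by omega)))
  refine ⟨fun l => f (2 * l), fun S => ((List.finRange k).map (e S)).prod, fun l S => ?_⟩
  -- the product is split at `l`: the factors before `l` lie in `U (f (2 * l)) m`, those after `l` in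
  -- the subgroup given by `U (f (2 * l))`
  obtain ⟨s, t, hst⟩ := List.append_of_mem (List.mem_finRange l)
  have hpw := List.pairwise_lt_finRange k
  have hlen : s.length ≤ k := by
    have := congrArg List.length hst
    simp at this
    omega
  rw [hst] at hpw ⊢
  rw [List.pairwise_append, List.pairwise_cons] at hpw
  dsimp only
  rw [List.map_append, List.prod_append, List.map_cons, List.prod_cons]
  set V := hU (f (2 * l))
  have hu : (s.map (e S)).prod ∈ U (f (2 * l)) 4 := by
    refine V.prod_mem _ fun x hx => ?_
    obtain ⟨l', hl', rfl⟩ := List.mem_map.1 hx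
    rw [List.length_map]
    exact V.antitone (by omega) (hlt S l l' (hpw.2.2 l' hl' l (List.mem_cons_self ..)))
  have hw : (t.map (e S)).prod ∈ V.subgroup := by
    refine list_prod_mem fun x hx => ?_
    obtain ⟨l', hl', rfl⟩ := List.mem_map.1 hx
    exact hgt S l l' (hpw.2.1.1 l' hl')
  set x := (s.map (e S)).prod
  set y := (t.map (e S)).prod
  by_cases hS : l ∈ S
  · refine iff_of_true ?_ hS
    simp only [e, if_pos hS, one_mul]
    exact V.mul_mem hu (V.mem_subgroup.1 hw _)
  · refine iff_of_false (fun hg => hc (f (2 * l)) ?_) hS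
    simp only [e, if_neg hS] at hg
    -- the witness `c (f (2 * l))` is expressed through the product and elements of the subgroup
    have h1 : (x * (d l * y))⁻¹ * x ∈ U (f (2 * l)) 1 :=
      V.inv_mul_mem 1 _ hg _ (V.antitone (by omega) hu)
    have h2 : c (f (2 * l + 1)) * y ∈ V.subgroup :=
      mul_mem (V.mem_subgroup.2 (hc' _ _ (hf (by omega)))) hw
    have h3 := V.mul_mem (V.mem_subgroup.1 h2 2) h1
    convert h3 using 1
    simp only [d]
    group

end Chains

/-! ### Type-definable groups -/

section Groups

variable {A B : Set M} {α : Type w} {G : Set (α → M)} [Group G]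

/-- The graph of the multiplication, as a set of concatenated triples of tuples. -/
def mulGraph (G : Set (α → M)) [Group G] : Set (α ⊕ α ⊕ α → M) :=
  {p | ∃ x y : G, p = Sum.elim (x : α → M) (Sum.elim (y : α → M) ((x * y : G) : α → M))}

theorem mem_mulGraph {x y z : α → M} : Sum.elim x (Sum.elim y z) ∈ mulGraph G ↔
    ∃ (hx : x ∈ G) (hy : y ∈ G), ((⟨x, hx⟩ * ⟨y, hy⟩ : G) : α → M) = z := by
  constructor
  · rintro ⟨x', y', heq⟩
    obtain rfl : x = x' := funext fun i => congrFun heq (Sum.inl i)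
    obtain rfl : y = y' := funext fun i => congrFun heq (Sum.inr (Sum.inl i))
    obtain rfl : z = _ := funext fun i => congrFun heq (Sum.inr (Sum.inr i))
    exact ⟨x'.2, y'.2, rfl⟩
  · rintro ⟨hx, hy, rfl⟩
    exact ⟨⟨x, hx⟩, ⟨y, hy⟩, rfl⟩

theorem coe_mem_mulGraph {x y z : G} :
    Sum.elim (x : α → M) (Sum.elim (y : α → M) z) ∈ mulGraph G ↔ x * y = z := by
  simp [mem_mulGraph, Subtype.ext_iff]

theorem IsTypeDefinableGroup.typeDefinable_mulGraph (hG : IsTypeDefinableGroup L A G) :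
    TypeDefinable L A (mulGraph G) := hG.typeDefinable_mul

theorem coe_mem_image {K : Subgroup G} {x : G} :
    (x : α → M) ∈ (fun g : G => (g : α → M)) '' (K : Set G) ↔ x ∈ K := by
  simp

theorem mem_relSet_leftRel {K : Subgroup G} {x y : G} :
    Sum.elim (x : α → M) y ∈ relSet (QuotientGroup.leftRel K) ↔ x⁻¹ * y ∈ K := by
  rw [coe_mem_relSet]
  exact QuotientGroup.leftRel_apply

theorem IsTypeDefinableGroup.isHyperdefinable [Nonempty M] (hM : IsMonster L κ M) (hα : #α < κ)
    (hG : IsTypeDefinableGroup L A G) (hAB : A ⊆ B) (hB : #B < κ) {K : Subgroup G}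
    (hK : IsTypeDefinableSubgroup L B K) : IsHyperdefinable L B G (QuotientGroup.leftRel K) where
  typeDefinable_set := hG.typeDefinable_set.mono hAB
  typeDefinable_rel := by
    have h1 := (TypeDefinable.preimage_comp (W := (α ⊕ α) ⊕ α)
      (Sum.elim (fun i => Sum.inl (Sum.inl i))
        (Sum.elim (fun i => Sum.inr i) (fun i => Sum.inl (Sum.inr i))))
      (hG.typeDefinable_mulGraph.mono hAB)).inter (TypeDefinable.preimage_comp Sum.inr hK)
    convert! h1.exists hM hB (hM.mk_sum_lt hα hα) hα using 1
    ext p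
    constructor
    · rintro ⟨x, y, hxy, rfl⟩
      refine ⟨((x⁻¹ * y : G) : α → M), ?_, coe_mem_image.2 (QuotientGroup.leftRel_apply.1 hxy)⟩
      rw [mem_preimage, Sum.comp_elim, Sum.comp_elim]
      exact coe_mem_mulGraph.2 (mul_inv_cancel_left x y)
    · rintro ⟨z', hz, ⟨z, hzK, hz'⟩⟩
      obtain rfl : (z : α → M) = z' := hz'
      rw [mem_preimage, Sum.comp_elim, Sum.comp_elim] at hz
      obtain ⟨hx, hz', heq⟩ := mem_mulGraph.1 hz
      refine ⟨⟨_, hx⟩, ⟨_, hx⟩ * z, QuotientGroup.leftRel_apply.2 (by simpa using hzK), ?_⟩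
      ext (i | i)
      · rfl
      · exact (congrFun heq i).symm

/-- Compactness for conditions of the form `x⁻¹ * y ∈ D` on a type-definable group. -/
theorem IsTypeDefinableGroup.exists_nhds_inv_mul [Nonempty M] (hM : IsMonster L κ M) (hα : #α < κ)
    (hG : IsTypeDefinableGroup L A G) (hAB : A ⊆ B) (hB : #B < κ) {D : Set (α → M)}
    (hD : B.Definable L D) {W : Type w} {S : Set (W → M)} (hS : TypeDefinable L B S) {J : Type*}
    (f : J → W → Fin 2 × α)
    (h : ∀ x y : G, (∀ j, (fun p => ![(x : α → M), y] p.1 p.2) ∘ f j ∈ S) →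
      ((x⁻¹ * y : G) : α → M) ∈ D) :
    ∃ D' ∈ DefNhds L B S, ∀ x y : G,
      (∀ j, (fun p => ![(x : α → M), y] p.1 p.2) ∘ f j ∈ D') → ((x⁻¹ * y : G) : α → M) ∈ D := by
  -- the variables are those of `x`, `y` and `x⁻¹ * y`
  let g : α ⊕ α ⊕ α → (Fin 2 × α) ⊕ α := Sum.elim (fun i => Sum.inl (0, i))
    (Sum.elim Sum.inr fun i => Sum.inl (1, i))
  have hg : ∀ v : (Fin 2 × α) ⊕ α → M, v ∘ g = Sum.elim (fun i => v (Sum.inl (0, i)))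
      (Sum.elim (fun i => v (Sum.inr i)) fun i => v (Sum.inl (1, i))) := fun v => by
    rw [Sum.comp_elim, Sum.comp_elim]; rfl
  obtain ⟨D', hD', h'⟩ := hM.exists_nhds hB (V := (Fin 2 × α) ⊕ α)
    (hM.mk_sum_lt (hM.mk_fin_prod_lt 2 hα) hα) (f := fun j => Sum.inl ∘ f j) hS
    (T := (fun v : (Fin 2 × α) ⊕ α → M => v ∘ g) ⁻¹' mulGraph G ∩ (fun v => v ∘ Sum.inr) ⁻¹' Dᶜ)
    ((TypeDefinable.preimage_comp _ (hG.typeDefinable_mulGraph.mono hAB)).inter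
      (TypeDefinable.preimage_comp _ (typeDefinable_of_definable hD.compl)))
    (fun v hv hvS => by
      have h1 : v ∘ g ∈ mulGraph G := hv.1
      rw [hg] at h1
      obtain ⟨hx, hz, heq⟩ := mem_mulGraph.1 h1
      set x : G := ⟨_, hx⟩
      set z : G := ⟨_, hz⟩
      refine hv.2 ?_
      have h2 := h x (x * z) fun j => by
        convert hvS j using 1
        funext i
        simp only [Function.comp_apply]
        generalize f j i = p
        obtain ⟨k, i⟩ := p
        fin_cases k
        · rfl
        · exact congrFun heq i
      rwa [inv_mul_cancel_left] at h2)
  refine ⟨D', hD', fun x y hxy => ?_⟩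
  by_contra hcon
  refine h' (Sum.elim (fun p => ![(x : α → M), y] p.1 p.2) ((x⁻¹ * y : G) : α → M)) ⟨?_, hcon⟩ hxy
  rw [mem_preimage, hg]
  exact coe_mem_mulGraph.2 (mul_inv_cancel_left x y)

theorem IsTypeDefinableGroup.exists_nhds_subgroup [Nonempty M] (hM : IsMonster L κ M)
    (hα : #α < κ) (hG : IsTypeDefinableGroup L A G) (hAB : A ⊆ B) (hB : #B < κ) {K : Subgroup G}
    (hK : IsTypeDefinableSubgroup L B K) {D : Set (α → M)}
    (hD : D ∈ DefNhds L B ((fun g : G => (g : α → M)) '' (K : Set G))) :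
    ∃ D' ∈ DefNhds L B ((fun g : G => (g : α → M)) '' (K : Set G)),
      ∀ x y : G, (x : α → M) ∈ D' → (y : α → M) ∈ D' → ((x⁻¹ * y : G) : α → M) ∈ D := by
  obtain ⟨D', hD', h⟩ := hG.exists_nhds_inv_mul hM hα hAB hB hD.1 hK (J := Fin 2)
    (fun j i => (j, i)) fun x y hxy => hD.2 (coe_mem_image.2
      (mul_mem (inv_mem (coe_mem_image.1 (hxy 0))) (coe_mem_image.1 (hxy 1))))
  refine ⟨D', hD', fun x y hx hy => h x y fun j => ?_⟩
  fin_cases j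
  · exact hx
  · exact hy

/-- If `K` has bounded index, then every definable neighbourhood of `K` has finitely many
translates that cover the group. -/
theorem IsTypeDefinableGroup.exists_cover [Nonempty M] (hM : IsMonster L κ M) (hα : #α < κ)
    (hG : IsTypeDefinableGroup L A G) (hAB : A ⊆ B) (hB : #B < κ) {K : Subgroup G}
    (hK : IsTypeDefinableSubgroup L B K) (hb : #(G ⧸ K) < κ) {D : Set (α → M)}
    (hD : D ∈ DefNhds L B ((fun g : G => (g : α → M)) '' (K : Set G))) :
    ∃ T : Finset G, ∀ g : G, ∃ t ∈ T, ((t⁻¹ * g : G) : α → M) ∈ D := by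
  have hE := hG.isHyperdefinable hM hα hAB hB hK
  obtain ⟨D', hD', h⟩ := hG.exists_nhds_inv_mul hM hα hAB hB hD.1 hE.typeDefinable_relSet
    (J := Unit) (fun _ => Sum.elim (fun i => (0, i)) fun i => (1, i)) fun x y hxy => by
      have := hxy ()
      rw [Sum.comp_elim] at this
      exact hD.2 (coe_mem_image.2 (mem_relSet_leftRel.1 this))
  obtain ⟨T, hT⟩ := IsBoundedRel.exists_cover hM hB hα hE.typeDefinable_set hb hD'
  refine ⟨T, fun y => ?_⟩
  obtain ⟨x, hx, hxy⟩ := hT y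
  refine ⟨x, hx, h x y fun _ => ?_⟩
  rw [Sum.comp_elim]
  exact hxy

variable (L) in
/-- A sequence of definable sets, over countably many parameters altogether, whose traces on the
group form a chain, such that `N n` translates of the `n`-th one cover the group. -/
structure IsDefChain (G : Set (α → M)) [Group G] (D : ℕ → Set (α → M)) (N : ℕ → ℕ) : Prop where
  definable : ∃ B : Set M, B.Countable ∧ ∀ n, B.Definable L (D n)
  isNhdChain : IsNhdChain fun n => {g : G | (g : α → M) ∈ D n}
  cover : ∀ n, ∃ T : Finset G, T.card ≤ N n ∧ ∀ g : G, ∃ t ∈ T, ((t⁻¹ * g : G) : α → M) ∈ D n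

/-- A type-definable subgroup of bounded index is an intersection of subgroups given by chains. -/
theorem IsTypeDefinableGroup.exists_isDefChain [Nonempty M] (hM : IsMonster L κ M) (hα : #α < κ)
    (hG : IsTypeDefinableGroup L A G) (hAB : A ⊆ B) (hB : #B < κ) {K : Subgroup G}
    (hK : IsTypeDefinableSubgroup L B K) (hb : #(G ⧸ K) < κ) {c : G} (hc : c ∉ K) :
    ∃ D N, IsDefChain L G D N ∧ (c : α → M) ∉ D 0 := by
  have hc' : (c : α → M) ∉ (fun g : G => (g : α → M)) '' (K : Set G) := fun h =>
    hc (coe_mem_image.1 h)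
  have hK' : TypeDefinable L B ((fun g : G => (g : α → M)) '' (K : Set G)) := hK
  rw [hK'.mem_iff] at hc'
  push Not at hc'
  obtain ⟨D₀, hD₀, hcD₀⟩ := hc'
  choose! F hF hF' using fun D hD =>
    hG.exists_nhds_subgroup (D := D) hM hα hAB hB hK hD
  let D : ℕ → Set (α → M) := fun n => F^[n] D₀
  have hD : ∀ n, D n ∈ DefNhds L B ((fun g : G => (g : α → M)) '' (K : Set G)) := by
    intro n
    induction n with
    | zero => exact hD₀
    | succ n ih =>
      change F^[n + 1] D₀ ∈ _
      rw [Function.iterate_succ_apply']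
      exact hF _ ih
  choose T hT using fun n => hG.exists_cover hM hα hAB hB hK hb (hD n)
  choose P hP hP' using fun n => definable_iff_finitely_definable.1 (hD n).1
  refine ⟨D, fun n => (T n).card, ⟨⟨⋃ n, (P n : Set M), countable_iUnion fun n =>
    (P n).countable_toSet, fun n => (hP' n).mono (subset_iUnion (fun n => (P n : Set M)) n)⟩,
    ⟨fun n => (hD n).2 ⟨1, one_mem K, rfl⟩, fun n x hx y hy => ?_⟩, fun n => ⟨T n, le_rfl, hT n⟩⟩,
    hcD₀⟩
  refine hF' (D n) (hD n) x y ?_ ?_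
  · rw [← Function.iterate_succ_apply' F n D₀]; exact hx
  · rw [← Function.iterate_succ_apply' F n D₀]; exact hy

/-! ### The connected component in NIP theories -/

/-- NIP, for formulas in which the two groups of variables may be infinite. -/
theorem IsNIP.exists_bound (h : IsNIP L M) {V W : Type*} {Φ : Set (V ⊕ W → M)}
    (hΦ : (∅ : Set M).Definable L Φ) : ∃ k : ℕ, ¬ ∃ (a : Fin k → V → M) (b : Set (Fin k) → W → M),
      ∀ (i : Fin k) (S : Set (Fin k)), Sum.elim (a i) (b S) ∈ Φ ↔ i ∈ S := by
  classical
  obtain ⟨φ, rfl⟩ := empty_definable_iff.1 hΦ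
  let F₁ := φ.freeVarFinset.toLeft
  let F₂ := φ.freeVarFinset.toRight
  let ψ : L.Formula (Fin F₁.card ⊕ Fin F₂.card) := φ.restrictFreeVar fun x => Sum.casesOn x.1
    (fun x hx => Sum.inl (F₁.equivFin ⟨x, by simpa [F₁] using hx⟩))
    (fun x hx => Sum.inr (F₂.equivFin ⟨x, by simpa [F₂] using hx⟩)) x.2
  have hψ : ∀ (a : V → M) (b : W → M), φ.Realize (Sum.elim a b) ↔
      ψ.Realize (Sum.elim (fun i => a (F₁.equivFin.symm i)) fun i => b (F₂.equivFin.symm i)) :=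
    fun a b => (BoundedFormula.realize_restrictFreeVar _ (by
      rintro ⟨x | x, hx⟩ <;> simp)).symm
  obtain ⟨k, hk⟩ := h _ _ ψ
  refine ⟨k, fun ⟨a, b, hab⟩ => hk ⟨fun i j => a i (F₁.equivFin.symm j),
    fun S j => b S (F₂.equivFin.symm j), fun i S => ?_⟩⟩
  rw [← hψ]
  exact hab i S

/-- A definable set is given by a set definable without parameters and a sequence of parameters. -/
theorem exists_params [Nonempty M] {D : Set (α → M)} (hD : B.Definable L D) :
    ∃ (Φ : Set (ℕ ⊕ α → M)) (b : ℕ → M), (∅ : Set M).Definable L Φ ∧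
      D = {x | Sum.elim b x ∈ Φ} := by
  obtain ⟨P, -, hP⟩ := definable_iff_finitely_definable.1 hD
  obtain ⟨φ, rfl⟩ := definable_iff_exists_formula_sum.1 hP
  let e : {m // m ∈ (P : Set M)} → ℕ := fun p => P.equivFin p
  have he : Function.Injective e := Fin.val_injective.comp P.equivFin.injective
  refine ⟨Set.ofPred (φ.relabel (Sum.map e id)).Realize, Function.extend e (fun p => p)
    fun _ => Classical.arbitrary M, empty_definable_iff.2 ⟨_, rfl⟩, ?_⟩
  ext x
  simp only [mem_ofPred_eq, Formula.realize_relabel]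
  convert! Iff.rfl using 2
  ext (p | i)
  · exact he.extend_apply (fun p => (p : M)) (fun _ => Classical.arbitrary M) p
  · rfl

end Groups

section Groups

variable {A B : Set M} {α : Type w} {G : Set (α → M)} [Group G]

/-- Under NIP, among the chains `D` whose members `D 2` are given by instances of one and the same
formula `Φ` and that have the same covering numbers `N`, finitely many ones already cut down the
group to a subset of every `D 0`. -/
theorem exists_finset_isDefChain (h : IsNIP L M) {Φ : Set (ℕ ⊕ α → M)}
    (hΦ : (∅ : Set M).Definable L Φ) (N : ℕ → ℕ) :
    ∃ 𝓕 : Finset (ℕ → Set (α → M)), (∀ D ∈ 𝓕, IsDefChain L G D N) ∧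
      ∀ c : G, (∀ D ∈ 𝓕, ∀ n, (c : α → M) ∈ D n) → ∀ D, IsDefChain L G D N →
        (∃ b : ℕ → M, D 2 = {x | Sum.elim b x ∈ Φ}) → (c : α → M) ∈ D 0 := by
  classical
  by_contra! hcon
  obtain ⟨f, hf, hf'⟩ := exists_seq_of_forall_finset_exists
    (fun p : (ℕ → Set (α → M)) × G => IsDefChain L G p.1 N ∧
      (∃ b : ℕ → M, p.1 2 = {x | Sum.elim b x ∈ Φ}) ∧ (p.2 : α → M) ∉ p.1 0)
    (fun p q => ∀ n, (q.2 : α → M) ∈ p.1 n) (fun s hs => by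
      obtain ⟨c, hc, D, hD, hb, hcD⟩ := hcon (s.image Prod.fst) (fun D hD => by
        obtain ⟨p, hp, rfl⟩ := Finset.mem_image.1 hD
        exact (hs p hp).1)
      exact ⟨(D, c), ⟨hD, hb, hcD⟩, fun p hp => hc _ (Finset.mem_image_of_mem _ hp)⟩)
  choose hD hb hc using hf
  choose b hb using hb
  obtain ⟨k, hk⟩ := h.exists_bound hΦ
  obtain ⟨i, g, hig⟩ := exists_shattered (fun i => (hD i).isNhdChain) (fun i n => (hD i).cover n)
    (c := fun i => (f i).2) hc (fun i j hij n => hf' i j hij n) k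
  refine hk ⟨fun l => b (i l), fun S => g S, fun l S => ?_⟩
  rw [← hig]
  exact (Set.ext_iff.1 (hb (i l)) (g S)).symm

/-- In a NIP theory, `G⁰⁰` exists for every type-definable group `G`. -/
theorem IsTypeDefinableGroup.exists_isG00 [Nonempty M] (hM : IsMonster L κ M) (h : IsNIP L M)
    (hA : #A < κ) (hα : #α < κ) (hG : IsTypeDefinableGroup L A G) :
    ∃ H : Subgroup G, IsG00 L κ G H := by
  -- the chains are sorted by the formula defining `D 2` and by the covering numbers
  let C := {Φ : Set (ℕ ⊕ α → M) // (∅ : Set M).Definable L Φ} × (ℕ → ℕ)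
  have hC : #C < κ := by
    have h1 : #(ℕ ⊕ α) < κ := by
      rw [mk_sum, mk_nat, lift_aleph0, lift_uzero]
      exact add_lt_of_lt hM.aleph0_lt.le hM.aleph0_lt hα
    have h2 : #(∅ : Set M) < κ := by
      rw [mk_eq_zero]
      exact aleph0_pos.trans hM.aleph0_lt
    have h3 : lift.{w} #(ℕ → ℕ) < κ := by
      have := hM.isStrongLimit.isStrongPrelimit hM.aleph0_lt
      simpa using this
    rw [mk_prod, lift_uzero]
    exact mul_lt_of_lt hM.aleph0_lt.le (hM.mk_definable_lt h2 h1) h3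
  -- `H` is the intersection of the subgroups given by the finitely many chains chosen for each sort
  choose 𝓕 h𝓕 h𝓕' using fun χ : C => exists_finset_isDefChain (G := G) h χ.1.2 χ.2
  let ι := Σ χ : C, 𝓕 χ
  have hι : #ι < κ := by
    rw [mk_sigma]
    refine (sum_le_sum _ (fun _ => ℵ₀) fun χ => mk_le_aleph0).trans_lt ?_
    rw [sum_const']
    exact mul_lt_of_lt hM.aleph0_lt.le hC hM.aleph0_lt
  have hD : ∀ i : ι, IsDefChain L G i.2 i.1.2 := fun i => h𝓕 i.1 i.2 i.2.2
  let H : Subgroup G := ⨅ i : ι, (hD i).isNhdChain.subgroup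
  have hH : ∀ {g : G}, g ∈ H ↔ ∀ (i : ι) (n : ℕ), (g : α → M) ∈ i.2.1 n := by
    intro g
    rw [Subgroup.mem_iInf]
    exact forall_congr' fun i => (hD i).isNhdChain.mem_subgroup
  choose P hP hP' using fun i => (hD i).definable
  choose T hT hT' using fun i => (hD i).cover
  refine ⟨H, ⟨⟨A ∪ ⋃ i, P i, hM.mk_union_lt hA ?_, ?_⟩, ?_⟩, ?_⟩
  · refine (mk_iUnion_le _).trans_lt (mul_lt_of_lt hM.aleph0_lt.le hι ?_)
    exact (ciSup_le' fun i => (hP i).le_aleph0).trans_lt hM.aleph0_lt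
  · have : (fun g : G => (g : α → M)) '' (H : Set G) = G ∩ ⋂ (i : ι) (n : ℕ), i.2.1 n := by
      ext x
      simp only [mem_inter_iff, mem_iInter]
      constructor
      · rintro ⟨g, hg, rfl⟩
        exact ⟨g.2, hH.1 hg⟩
      · rintro ⟨hx, hx'⟩
        exact ⟨⟨x, hx⟩, hH.2 hx', rfl⟩
    unfold IsTypeDefinableSubgroup
    rw [this]
    refine (hG.typeDefinable_set.mono subset_union_left).inter (typeDefinable_iInter fun i =>
      typeDefinable_iInter fun n => typeDefinable_of_definable ((hP' i n).mono ?_))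
    exact (subset_iUnion P i).trans subset_union_right
  · -- a coset is determined by the translates that it meets
    let F : G ⧸ H → Set (Σ p : ι × ℕ, T p.1 p.2) := fun c =>
      {t | ((t.2.1⁻¹ * c.out : G) : α → M) ∈ t.1.1.2.1 t.1.2}
    have hF : Function.Injective F := by
      intro c c' hcc
      rw [← Quotient.out_eq c, ← Quotient.out_eq c']
      refine Quotient.sound (QuotientGroup.leftRel_apply.2 (hH.2 fun i n => ?_))
      obtain ⟨t, ht, htc⟩ := hT' i (n + 1) c.out
      have h1 : (⟨(i, n + 1), t, ht⟩ : Σ p : ι × ℕ, T p.1 p.2) ∈ F c := htc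
      rw [hcc] at h1
      have := (hD i).isNhdChain.inv_mul_mem n _ htc _ h1
      rwa [mul_inv_rev, inv_inv, mul_assoc, mul_inv_cancel_left] at this
    refine (mk_le_of_injective hF).trans_lt ?_
    rw [mk_set]
    refine hM.isStrongLimit.isStrongPrelimit ?_
    rw [mk_sigma]
    refine (sum_le_sum _ (fun _ => ℵ₀) fun χ => mk_le_aleph0).trans_lt ?_
    rw [sum_const', mk_prod, mk_nat, lift_aleph0, lift_uzero]
    exact mul_lt_of_lt hM.aleph0_lt.le (mul_lt_of_lt hM.aleph0_lt.le hι hM.aleph0_lt) hM.aleph0_lt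
  · rintro K ⟨⟨B, hB, hK⟩, hb⟩ c hc
    by_contra hcK
    obtain ⟨D, N, hDN, hcD⟩ := hG.exists_isDefChain hM hα (B := A ∪ B) subset_union_left
      (hM.mk_union_lt hA hB) (TypeDefinable.mono hK subset_union_right) hb hcK
    obtain ⟨Q, -, hQ⟩ := hDN.definable
    obtain ⟨Φ, b, hΦ, hbΦ⟩ := exists_params (hQ 2)
    exact hcD (h𝓕' (⟨Φ, hΦ⟩, N) c (fun D' hD' n => hH.1 hc ⟨_, D', hD'⟩ n) D hDN ⟨b, hbΦ⟩)

end Groups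

/-! ### The empty structure -/

section Empty

variable {α : Type w} {X : Set (α → M)}

theorem subsingleton_of_isEmpty [IsEmpty M] {Y : Set (α → M)} : Subsingleton Y :=
  ⟨fun x _ => Subtype.ext (funext fun i => isEmptyElim ((x : α → M) i))⟩

theorem IsMonster.isBoundedRel_of_isEmpty [IsEmpty M] (hM : IsMonster L κ M) (E : Setoid X) :
    IsBoundedRel κ E := by
  have := subsingleton_of_isEmpty (Y := X)
  exact (le_one_iff_subsingleton.2 inferInstance).trans_lt (one_lt_aleph0.trans hM.aleph0_lt)

theorem isStable_of_isEmpty [IsEmpty M] (A : Set M) (E : Setoid X) : IsStable L κ A E := by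
  have := subsingleton_of_isEmpty (Y := X)
  intro β _ c b _ i j _
  refine ⟨FirstOrder.Language.Equiv.refl L M, fun _ _ => rfl, fun _ => ⟨?_, fun k =>
    isEmptyElim (b i k)⟩⟩
  obtain ⟨x, hx⟩ := Quotient.exists_rep (c i)
  exact ⟨x, x, hx, hx.trans (Subsingleton.elim _ _), fun _ => rfl⟩

end Empty

/-! ### Stable quotients and connected components -/

theorem IsMonster.isStable_iff_isBoundedRel (hM : IsMonster L κ M) (hd : IsDistal L κ M) {A : Set M}
    {α : Type w} {X : Set (α → M)} {E : Setoid X} (hA : #A < κ) (hα : #α < κ)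
    (hE : IsHyperdefinable L A X E) : IsStable L κ A E ↔ IsBoundedRel κ E := by
  rcases isEmpty_or_nonempty M with _ | _
  · exact iff_of_true (isStable_of_isEmpty A E) (hM.isBoundedRel_of_isEmpty E)
  · exact ⟨fun hs => hs.isBoundedRel hM hd hA hα hE, fun hb => hb.isStable hM hA hα hE⟩

/-- In a distal theory, the subgroups competing for `Gˢᵗ` and for `G⁰⁰` are the same. -/
theorem IsTypeDefinableGroup.isGst_iff_isG00 [Nonempty M] (hM : IsMonster L κ M)
    (hd : IsDistal L κ M) {A : Set M} {α : Type w} {G : Set (α → M)} [Group G] (hA : #A < κ)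
    (hα : #α < κ) (hG : IsTypeDefinableGroup L A G) (H : Subgroup G) :
    IsGst L κ A G H ↔ IsG00 L κ G H := by
  unfold IsGst IsG00
  congr! 1
  ext K
  constructor
  · rintro ⟨B, hB, hAB, hK, hs⟩
    exact ⟨⟨B, hB, hK⟩, (hM.isStable_iff_isBoundedRel hd hB hα
      (hG.isHyperdefinable hM hα hAB hB hK)).1 hs⟩
  · rintro ⟨⟨B, hB, hK⟩, hb⟩
    have hB' := hM.mk_union_lt hA hB
    have hK' : IsTypeDefinableSubgroup L (A ∪ B) K := TypeDefinable.mono hK subset_union_right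
    exact ⟨A ∪ B, hB', subset_union_left, hK', (hM.isStable_iff_isBoundedRel hd hB' hα
      (hG.isHyperdefinable hM hα subset_union_left hB' hK')).2 hb⟩

end Monster

theorem mainTheorem2 (L : FirstOrder.Language.{u, v}) (M : Type w) [L.Structure M]
    (κ : Cardinal.{w}) (hM : Monster.IsMonster L κ M) (hdistal : Monster.IsDistal L κ M) :
    (∀ (A : Set M) (α : Type w) (X : Set (α → M)) (E : Setoid X), #A < κ → #α < κ →
      Monster.IsHyperdefinable L A X E →
        (Monster.IsStable L κ A E ↔ Monster.IsBoundedRel κ E)) ∧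
    (Monster.IsNIP L M →
      ∀ (A : Set M) (α : Type w) (G : Set (α → M)) [Group G], #A < κ → #α < κ →
        Monster.IsTypeDefinableGroup L A G →
          ∃ H : Subgroup G, Monster.IsGst L κ A G H ∧ Monster.IsG00 L κ G H) := by
  refine ⟨fun A α X E hA hα hE => hM.isStable_iff_isBoundedRel hdistal hA hα hE,
    fun hN A α G _ hA hα hG => ?_⟩
  rcases isEmpty_or_nonempty M with _ | _
  · have := Monster.subsingleton_of_isEmpty (Y := G)
    have htop : Monster.IsTypeDefinableSubgroup L A (⊤ : Subgroup G) := by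
      simpa [Monster.IsTypeDefinableSubgroup] using hG.typeDefinable_set
    exact ⟨⊤, ⟨⟨A, hA, subset_rfl, htop, Monster.isStable_of_isEmpty A _⟩,
      fun K _ => (Subsingleton.elim _ _).le⟩, ⟨⟨⟨A, hA, htop⟩, hM.isBoundedRel_of_isEmpty _⟩,
        fun K _ => (Subsingleton.elim _ _).le⟩⟩
  · obtain ⟨H, hH⟩ := hG.exists_isG00 hM hN hA hα
    exact ⟨H, (hG.isGst_iff_isG00 hM hdistal hA hα H).2 hH, hH⟩
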